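/- Let $L$ (people) and $T$ (tasks) be finite sets with $|L|=|T|$, let $C=(c_{\ell t})\in\mathbb{R}^{L\times T}$ be a cost matrix, $m=|L||T|$, and $N=L\,\dot\cup\,T$, $n=|N|$. The pseudoflow polyhedron of the assignment problem is the set $P$ of all $(x,s^+,s^-)\in\mathbb{R}^{m}\times\mathbb{R}^n\times\mathbb{R}^n$ with $0\le x\le 1$, $s^+\ge 0$, $s^-\ge 0$, $\sum_{t} x_{\ell t}-s^+_\ell+s^-_\ell=1$ for all $\ell\in L$, and $-\sum_{\ell}x_{\ell t}-s^+_t+s^-_t=-1$ for all $t\in T$. A circuit of a polyhedron $\{y: Ay=b,\ By\le d\}$ is a vector $g\in\ker A\setminus\{0\}$ with coprime integer components for which the support of $Bg$ is inclusion-minimal among the supports of $Bh$, $h\in\ker A\setminus\{0\}$; it is feasible at $y$ if $y+\alpha g$ lies in the polyhedron for some $\alpha>0$. A circuit augmentation scheme for minimizing $c^Ty$ starts at a vertex, in each step moves by a maximal step along an improving ($c^Tg<0$) feasible circuit $g$, and stops when there is none; under Dantzig's rule, $g$ maximizes $-c^Tg$ among all circuits feasible at the current point. For every complete run of the Hungarian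 Method on $C$, consisting of the greedy starring of zeros after row and column subtraction and of the main loop with priming, covering, augmentation along alternating paths of primed and starred zeros, and updates of the matrix by the smallest uncovered element, let $\emptyset=M_0,M_1,\dots,M_r$ be the successive partial matchings (the sets of starred zeros), where $M_i$ arises from $M_{i-1}$ by augmenting along a path $H_i$ from a person $\ell_i$ to a task $t_i$ (a single arc in the greedy stage). Let $y_i=(x,s^+,s^-)$ be the point with $x$ the incidence vector of $M_i$, $s^+_t=1$ for unmatched tasks $t$, $s^-_\ell=1$ for unmatched people $\ell$, and all other slacks $0$; let $D=1+\sum_{\ell,t}|c_{\ell t}|$ and, for $M\in\mathbb{R}$, $$c_M=\Bigl(C,\ M\mathbf 1-2D\sum_{i=1}^r i\,e_{t_i},\ M\mathbf 1-2D\sum_{i=1}^r i\,e_{\ell_i}\Bigr).$$ Then there is a number $M^*$ depending only on $C$ such that for every complete run and every $M\ge M^*$ the following hold. 1. The sequence $y_0,\dots,y_r$ with the circuits $g_i=(H_i,-e_{t_i},-e_{\ell_i})$ leading from $y_{i-1}$ to $y_i$, $i=1,\dots,r$ (where $H_i$ also denotes the vector with $+1$ on the arcs that enter and $-1$ on the arcs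 that leave the matching), is a complete execution of a circuit augmentation scheme over $P$ for minimizing $c_M^Ty$ with Dantzig's rule: $y_0$ is a vertex of $P$, each $g_i$ is an improving circuit chosen by Dantzig's rule at $y_{i-1}$, the step from $y_{i-1}$ to $y_i$ is maximal, and no improving circuit is feasible at $y_r$. 2. However ties are broken, every circuit augmentation scheme over $P$ for $c_M$ that starts at $y_0$ and uses Dantzig's rule chooses in its $i$-th step, for each $i\le r$ that it reaches, a circuit with the same slack components $(-e_{t_i},-e_{\ell_i})$; that is, it matches the same pairs $(\ell_i,t_i)$ in the same order. -/

import Mathlib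

open scoped Matrix

namespace PseudoflowCircuits

noncomputable section

/-! ### Polyhedra, circuits and circuit augmentation -/

/-- A system `A y = b`, `B y ≤ d` of linear constraints in the variables `y : ι → ℝ`. -/
structure LinearSystem (ρ κ ι : Type*) where
  A : Matrix ρ ι ℝ
  b : ρ → ℝ
  B : Matrix κ ι ℝ
  d : κ → ℝ

namespace LinearSystem

variable {ρ κ ι : Type*} [Fintype ι]

/-- The polyhedron `{y | A y = b, B y ≤ d}`. -/
def polyhedron (Q : LinearSystem ρ κ ι) : Set (ι → ℝ) :=
  {y | Q.A *ᵥ y = Q.b ∧ Q.B *ᵥ y ≤ Q.d}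

/-- Circuits: nonzero vectors of `ker A` with coprime integer components such that the support of
`B g` is inclusion-minimal among the supports of `B h`, `h ∈ ker A \ {0}`. -/
def IsCircuit (Q : LinearSystem ρ κ ι) (g : ι → ℝ) : Prop :=
  g ≠ 0 ∧ Q.A *ᵥ g = 0 ∧
    (∃ z : ι → ℤ, (∀ i, g i = (z i : ℝ)) ∧ Finset.univ.gcd z = 1) ∧
    ∀ h : ι → ℝ, h ≠ 0 → Q.A *ᵥ h = 0 →
      Function.support (Q.B *ᵥ h) ⊆ Function.support (Q.B *ᵥ g) →
      Function.support (Q.B *ᵥ h) = Function.support (Q.B *ᵥ g)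

/-- `g` is a feasible circuit at `y`. -/
def IsFeasibleCircuit (Q : LinearSystem ρ κ ι) (y g : ι → ℝ) : Prop :=
  Q.IsCircuit g ∧ ∃ α : ℝ, 0 < α ∧ y + α • g ∈ Q.polyhedron

/-- Dantzig's rule for the minimization of `c`: the circuit `g` maximizes `-cᵀ g` among all
circuits that are feasible at `y`. -/
def IsDantzigCircuit (Q : LinearSystem ρ κ ι) (c y g : ι → ℝ) : Prop :=
  Q.IsFeasibleCircuit y g ∧
    ∀ h : ι → ℝ, Q.IsFeasibleCircuit y h → -(c ⬝ᵥ h) ≤ -(c ⬝ᵥ g)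

/-- `y'` is reached from `y` by a step of maximal length in direction `g`. -/
def IsMaximalStep (Q : LinearSystem ρ κ ι) (y g y' : ι → ℝ) : Prop :=
  ∃ α : ℝ, 0 < α ∧ y' = y + α • g ∧ y' ∈ Q.polyhedron ∧
    ∀ β : ℝ, α < β → y + β • g ∉ Q.polyhedron

/-- `y 0, …, y k` is a circuit walk of length `k`, with circuits `g 0, …, g (k - 1)`. -/
def IsCircuitWalk (Q : LinearSystem ρ κ ι) (k : ℕ) (y g : ℕ → ι → ℝ) : Prop :=
  y 0 ∈ Q.polyhedron.extremePoints ℝ ∧ (∀ i ≤ k, y i ∈ Q.polyhedron) ∧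
    ∀ i < k, Q.IsCircuit (g i) ∧ Q.IsMaximalStep (y i) (g i) (y (i + 1))

/-- A circuit walk of length `k` each of whose steps uses an improving circuit (for the
minimization of `c`) chosen by Dantzig's rule. -/
def IsDantzigWalk (Q : LinearSystem ρ κ ι) (c : ι → ℝ) (k : ℕ) (y g : ℕ → ι → ℝ) : Prop :=
  Q.IsCircuitWalk k y g ∧ ∀ i < k, Q.IsDantzigCircuit c (y i) (g i) ∧ c ⬝ᵥ g i < 0

/-- A complete execution of the circuit augmentation scheme with Dantzig's rule: it stops at
`y k`, where no improving circuit is feasible. -/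
def IsDantzigAugmentation (Q : LinearSystem ρ κ ι) (c : ι → ℝ) (k : ℕ) (y g : ℕ → ι → ℝ) : Prop :=
  Q.IsDantzigWalk c k y g ∧ ∀ h : ι → ℝ, Q.IsFeasibleCircuit (y k) h → 0 ≤ c ⬝ᵥ h

end LinearSystem

/-! ### Pseudoflow polyhedra -/

/-- A directed network with nodes `N` and arcs `A`. -/
structure Network (N A : Type*) where
  src : A → N
  tgt : A → N

/-- The node-arc incidence matrix. -/
def Network.incidence {N A : Type*} [DecidableEq N] (G : Network N A) : Matrix N A ℝ :=
  Matrix.of fun i a => (if G.src a = i then 1 else 0) - (if G.tgt a = i then 1 else 0)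

/-- The constraints of the pseudoflow polyhedron in the variables `(x, s⁺, s⁻)`:
`A_G x - s⁺ + s⁻ = b`, `x ≤ u` and `(x, s⁺, s⁻) ≥ 0`. -/
def pseudoflowSystem {N A : Type*} [DecidableEq N] [DecidableEq A] (G : Network N A)
    (b : N → ℝ) (u : A → ℝ) : LinearSystem N (A ⊕ (A ⊕ N ⊕ N)) (A ⊕ N ⊕ N) where
  A := Matrix.fromCols G.incidence (Matrix.fromCols (-1) 1)
  b := b
  B := Matrix.fromRows (Matrix.fromCols 1 0) (-1)
  d := Sum.elim u 0

/-- The complete bipartite network with an arc `(ℓ, t)` from each person `ℓ` to each task `t`. -/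
def assignmentNetwork (L T : Type*) : Network (L ⊕ T) (L × T) where
  src a := Sum.inl a.1
  tgt a := Sum.inr a.2

/-- The pseudoflow polyhedron of the assignment problem: supply `1` at each person, demand `1`
at each task, and capacity `1` on each arc. -/
def assignmentSystem (L T : Type*) [DecidableEq L] [DecidableEq T] :
    LinearSystem (L ⊕ T) ((L × T) ⊕ ((L × T) ⊕ (L ⊕ T) ⊕ (L ⊕ T)))
      ((L × T) ⊕ (L ⊕ T) ⊕ (L ⊕ T)) :=
  pseudoflowSystem (assignmentNetwork L T) (Sum.elim (fun _ => 1) (fun _ => -1)) (fun _ => 1)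

/-! ### The Hungarian Method -/

section Hungarian

variable {L T : Type*} [Fintype L] [Fintype T] [DecidableEq L] [DecidableEq T]

/-- Subtract from each row its smallest element. -/
def subtractRowMin (C : Matrix L T ℝ) : Matrix L T ℝ :=
  Matrix.of fun l t => C l t - ⨅ t', C l t'

/-- Subtract from each column its smallest element. -/
def subtractColMin (C : Matrix L T ℝ) : Matrix L T ℝ :=
  Matrix.of fun l t => C l t - ⨅ l', C l' t

/-- The positions of the zeros of a matrix. -/
def zeros (C : Matrix L T ℝ) : Finset (L × T) :=
  Finset.univ.filter fun z => C z.1 z.2 = 0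

/-- The data kept in the main loop: the current matrix, its starred and primed zeros, and the
covered rows and columns. -/
structure Tableau (L T : Type*) where
  cost : Matrix L T ℝ
  starred : Finset (L × T)
  primed : Finset (L × T)
  rows : Finset L
  cols : Finset T

/-- The position `z` holds an uncovered zero. -/
def Tableau.UncoveredZero (τ : Tableau L T) (z : L × T) : Prop :=
  τ.cost z.1 z.2 = 0 ∧ z.1 ∉ τ.rows ∧ z.2 ∉ τ.cols

/-- Control states: the greedy loop (with the zeros still to be visited), the head of the outer
`while` loop, the inner loop over uncovered zeros, and termination. -/
inductive HungarianState (L T : Type*)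
  | greedy (cost : Matrix L T ℝ) (todo starred : Finset (L × T))
  | outer (τ : Tableau L T)
  | inner (τ : Tableau L T)
  | done (τ : Tableau L T)

/-- `AlternatingPath S P ℓ t p`: the list `p` is an alternating sequence of primed zeros (in `P`)
and starred zeros (in `S`), beginning with a primed zero in row `ℓ` and ending with a primed zero
in column `t`. A primed zero is followed by the starred zero in its column, and a starred zero by
a primed zero in its row. The sequence is inclusion-maximal: it goes on until the column of the
primed zero reached contains no starred zero. -/
inductive AlternatingPath (S P : Finset (L × T)) : L → T → List (L × T) → Prop
  | last (l : L) (t : T) : (l, t) ∈ P → (∀ l', (l', t) ∉ S) → AlternatingPath S P l t [(l, t)]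
  | cons (l : L) (t' : T) (l' : L) (t : T) (p : List (L × T)) :
      (l, t') ∈ P → (l', t') ∈ S → AlternatingPath S P l' t p →
      AlternatingPath S P l t ((l, t') :: (l', t') :: p)

/-- An enlargement of the partial matching: the newly matched person and task, and the augmenting
path between them (alternately arcs that enter and arcs that leave the matching). -/
structure Augmentation (L T : Type*) where
  person : L
  task : T
  path : List (L × T)

/-- Unstar the starred zeros on a path and star its other zeros. -/
def flipAlong (S : Finset (L × T)) (p : List (L × T)) : Finset (L × T) :=
  (S \ p.toFinset) ∪ (p.toFinset \ S)

/-- The columns that contain a starred zero. -/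
def starredCols (S : Finset (L × T)) : Finset T := S.image Prod.snd

/-- `HungarianReaches C σ r`: started on the cost matrix `C`, the Hungarian Method can reach the
state `σ` after having performed exactly the augmentations in the list `r`, in that order (the
starring of a zero in the greedy stage is an augmentation along a path with a single arc). The
order in which zeros are visited is arbitrary. -/
inductive HungarianReaches (C : Matrix L T ℝ) :
    HungarianState L T → List (Augmentation L T) → Prop
  /-- Row and column subtraction; then all zeros have to be visited. -/
  | init : HungarianReaches C
      (.greedy (subtractColMin (subtractRowMin C))
        (zeros (subtractColMin (subtractRowMin C))) ∅) []
  /-- Star a visited zero if there is no starred zero in its row or column. -/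
  | greedyStar (C' : Matrix L T ℝ) (todo S : Finset (L × T)) (r : List (Augmentation L T))
      (z : L × T) :
      HungarianReaches C (.greedy C' todo S) r → z ∈ todo →
      (∀ s ∈ S, s.1 ≠ z.1 ∧ s.2 ≠ z.2) →
      HungarianReaches C (.greedy C' (todo.erase z) (insert z S)) (r ++ [⟨z.1, z.2, [z]⟩])
  /-- Otherwise skip it. -/
  | greedySkip (C' : Matrix L T ℝ) (todo S : Finset (L × T)) (r : List (Augmentation L T))
      (z : L × T) :
      HungarianReaches C (.greedy C' todo S) r → z ∈ todo →
      (∃ s ∈ S, s.1 = z.1 ∨ s.2 = z.2) →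
      HungarianReaches C (.greedy C' (todo.erase z) S) r
  /-- When all zeros have been visited, cover every column that contains a starred zero. -/
  | greedyEnd (C' : Matrix L T ℝ) (S : Finset (L × T)) (r : List (Augmentation L T)) :
      HungarianReaches C (.greedy C' ∅ S) r →
      HungarianReaches C (.outer ⟨C', S, ∅, ∅, starredCols S⟩) r
  /-- The outer loop is entered while there is an uncovered zero. -/
  | outerEnter (τ : Tableau L T) (r : List (Augmentation L T)) :
      HungarianReaches C (.outer τ) r → (∃ z, τ.UncoveredZero z) →
      HungarianReaches C (.inner τ) r
  /-- Otherwise the method stops. -/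
  | outerExit (τ : Tableau L T) (r : List (Augmentation L T)) :
      HungarianReaches C (.outer τ) r → (∀ z, ¬ τ.UncoveredZero z) →
      HungarianReaches C (.done τ) r
  /-- Prime an uncovered zero `z` whose row contains a starred zero `s`; cover the row of `z` and
  uncover the column of `s`. -/
  | innerPrime (τ : Tableau L T) (r : List (Augmentation L T)) (z s : L × T) :
      HungarianReaches C (.inner τ) r → τ.UncoveredZero z → s ∈ τ.starred → s.1 = z.1 →
      HungarianReaches C
        (.inner ⟨τ.cost, τ.starred, insert z τ.primed, insert z.1 τ.rows, τ.cols.erase s.2⟩) r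
  /-- Prime an uncovered zero `(l, t₀)` in a row without a starred zero and augment along an
  alternating path that begins with it; erase all primes, uncover all rows, cover all columns with
  a starred zero, and go on if some column is not covered. -/
  | innerAugment (τ : Tableau L T) (r : List (Augmentation L T)) (l : L) (t₀ t : T)
      (p : List (L × T)) :
      HungarianReaches C (.inner τ) r → τ.UncoveredZero (l, t₀) →
      (∀ t', (l, t') ∉ τ.starred) →
      AlternatingPath τ.starred (insert (l, t₀) τ.primed) l t ((l, t₀) :: p) →
      ((l, t₀) :: p).Nodup →
      starredCols (flipAlong τ.starred ((l, t₀) :: p)) ≠ Finset.univ →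
      HungarianReaches C
        (.inner ⟨τ.cost, flipAlong τ.starred ((l, t₀) :: p), ∅, ∅,
          starredCols (flipAlong τ.starred ((l, t₀) :: p))⟩)
        (r ++ [⟨l, t, (l, t₀) :: p⟩])
  /-- The same, but all columns are covered afterwards: terminate. -/
  | innerFinish (τ : Tableau L T) (r : List (Augmentation L T)) (l : L) (t₀ t : T)
      (p : List (L × T)) :
      HungarianReaches C (.inner τ) r → τ.UncoveredZero (l, t₀) →
      (∀ t', (l, t') ∉ τ.starred) →
      AlternatingPath τ.starred (insert (l, t₀) τ.primed) l t ((l, t₀) :: p) →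
      ((l, t₀) :: p).Nodup →
      starredCols (flipAlong τ.starred ((l, t₀) :: p)) = Finset.univ →
      HungarianReaches C
        (.done ⟨τ.cost, flipAlong τ.starred ((l, t₀) :: p), ∅, ∅,
          starredCols (flipAlong τ.starred ((l, t₀) :: p))⟩)
        (r ++ [⟨l, t, (l, t₀) :: p⟩])
  /-- There are no more uncovered zeros: with `h` the smallest uncovered element, add `h` to each
  covered row and subtract `h` from each uncovered column. -/
  | innerUpdate (τ : Tableau L T) (r : List (Augmentation L T)) (h : ℝ) :
      HungarianReaches C (.inner τ) r → (∀ z, ¬ τ.UncoveredZero z) →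
      IsLeast {x | ∃ l t, l ∉ τ.rows ∧ t ∉ τ.cols ∧ x = τ.cost l t} h →
      HungarianReaches C
        (.outer ⟨Matrix.of fun l t =>
            τ.cost l t + (if l ∈ τ.rows then h else 0) - (if t ∈ τ.cols then 0 else h),
          τ.starred, τ.primed, τ.rows, τ.cols⟩) r

/-- `r` lists the augmentations of a complete run (until termination) of the Hungarian Method. -/
def IsHungarianRun (C : Matrix L T ℝ) (r : List (Augmentation L T)) : Prop :=
  ∃ τ : Tableau L T, HungarianReaches C (.done τ) r

/-- The set of starred zeros (the partial matching) after the first `i` augmentations. -/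
def matchingAfter (r : List (Augmentation L T)) (i : ℕ) : Finset (L × T) :=
  (r.take i).foldl (fun S a => flipAlong S a.path) ∅

/-! ### The corresponding circuit walk and the objective function -/

/-- The point `(x, s⁺, s⁻)` of a partial matching `S`: `x` is its incidence vector, `s⁺ = 1` at
the unmatched tasks, `s⁻ = 1` at the unmatched persons, and all other slacks are zero. -/
def matchingPoint (S : Finset (L × T)) : (L × T) ⊕ (L ⊕ T) ⊕ (L ⊕ T) → ℝ :=
  Sum.elim (fun a => if a ∈ S then 1 else 0)
    (Sum.elim
      (Sum.elim (fun _ => 0) (fun t => if ∃ l, (l, t) ∈ S then 0 else 1))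
      (Sum.elim (fun l => if ∃ t, (l, t) ∈ S then 0 else 1) (fun _ => 0)))

/-- The vector with entries `+1, -1, +1, …` on the successive arcs of a path. -/
def pathVector : List (L × T) → L × T → ℝ
  | [] => 0
  | a :: p => Pi.single a 1 - pathVector p

/-- The path circuit `(H, -e_t, -e_ℓ)` of an augmentation along a path `H` from `ℓ` to `t`. -/
def Augmentation.circuit (a : Augmentation L T) : (L × T) ⊕ (L ⊕ T) ⊕ (L ⊕ T) → ℝ :=
  Sum.elim (pathVector a.path)
    (Sum.elim (-Pi.single (Sum.inr a.task) 1) (-Pi.single (Sum.inl a.person) 1))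

/-- The `i`-th point of the walk of the Hungarian Method. -/
def hungarianPoint (r : List (Augmentation L T)) (i : ℕ) : (L × T) ⊕ (L ⊕ T) ⊕ (L ⊕ T) → ℝ :=
  matchingPoint (matchingAfter r i)

/-- The `i`-th circuit of the walk of the Hungarian Method (and `0` for `i ≥ r.length`). -/
def hungarianCircuit (r : List (Augmentation L T)) (i : ℕ) : (L × T) ⊕ (L ⊕ T) ⊕ (L ⊕ T) → ℝ :=
  (r[i]?).elim 0 Augmentation.circuit

/-- `D = 1 + ∑ |c_{ℓ t}|`. -/
def costBound (C : Matrix L T ℝ) : ℝ := 1 + ∑ a : L × T, |C a.1 a.2|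

/-- The objective `(c_x, M·1 - 2 D ∑ᵢ i e_{tᵢ}, M·1 - 2 D ∑ᵢ i e_{ℓᵢ})`, where `(ℓᵢ, tᵢ)` is
the pair matched by the `i`-th augmentation, `i = 1, 2, …` (list indices start at `0`). -/
def objective (C : Matrix L T ℝ) (M : ℝ) (r : List (Augmentation L T)) :
    (L × T) ⊕ (L ⊕ T) ⊕ (L ⊕ T) → ℝ :=
  Sum.elim (fun a => C a.1 a.2)
    (Sum.elim
      (fun v => M - 2 * costBound C *
        ∑ i : Fin r.length, ((i : ℕ) + 1 : ℝ) * (Pi.single (Sum.inr r[i].task) 1 : L ⊕ T → ℝ) v)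
      (fun v => M - 2 * costBound C *
        ∑ i : Fin r.length, ((i : ℕ) + 1 : ℝ) * (Pi.single (Sum.inl r[i].person) 1 : L ⊕ T → ℝ) v))

end Hungarian

end

end PseudoflowCircuits

open PseudoflowCircuits

/-! Add a root to the network and read `s⁺ v` as an arc from the root to `v`, and `s⁻ v` as an arc
from `v` to the root. The kernel of the constraint matrix then consists of the circulations of the
extended network, and circuits are signed incidence vectors of simple cycles (`isCircuit_unit`).
Such a cycle passes the root at most once, so it uses no slack arc or exactly two
(`isCircuit_slack`).

Write `D` for `costBound C` and `n` for the length of the run. The arcs of a circuit contribute at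
most `D - 1` to its cost in absolute value. At a point that matches the first `k` pairs (`IsStage`),
a circuit lowers two slacks only if these belong to an unmatched person and an unmatched task, of
indices `i, j ≥ k` in the run; the slack part of its cost is then `-2M + 2D((i+1)+(j+1))`. The slack
part of any other circuit is at least `-2Dn`, so for large `M` it cannot compete
(`IsStage.slack_cases`). The choice `i = j = k` beats all other pairs by at least `2D`, more than
the arc costs can offset (`IsStage.pairSlack_or_lt`). Hence Dantzig's rule must match the next pair,
and it does so with a unit step. This gives the second claim by induction, and uses only that each
person and each task occurs once in the run.

For the first claim, among the circuits for the next pair the one of the run must have least arc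
cost. The Hungarian Method maintains reduced costs, that is, a potential `u + v ≤ C` that is tight
on the matching, and augments along zeros, that is, tight arcs (`HungarianReaches.stateInv`). The
potential cost of a kernel vector depends only on its slacks (`sum_potential_eq`); it is a lower
bound for the arc cost of a feasible circuit (`IsPotential.sum_le`), attained on tight paths. The
same argument with zero slacks shows that the last point is optimal (`TightRun.optimal`). -/

namespace PseudoflowCircuits

/-! ### Unit cycles in the support of a circulation -/

section Circulation

variable {E V : Type*} [DecidableEq V]

/-- Flow conservation at every node. -/
def IsCirculation [Fintype E] (tl hd : E → V) (h : E → ℝ) : Prop :=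
  ∀ v, ∑ e, h e * ((if tl e = v then 1 else 0) - (if hd e = v then 1 else 0)) = 0

/-- The tail of `e` with respect to the direction of the flow `h`. -/
noncomputable def flowTail (tl hd : E → V) (h : E → ℝ) (e : E) : V :=
  if 0 < h e then tl e else hd e

/-- The head of `e` with respect to the direction of the flow `h`. -/
noncomputable def flowHead (tl hd : E → V) (h : E → ℝ) (e : E) : V :=
  if 0 < h e then hd e else tl e

/-- Reversing the arcs with negative flow turns `h` into the nonnegative flow `|h|`. -/
theorem mul_incidence_eq_abs (tl hd : E → V) (h : E → ℝ) (e : E) (v : V) :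
    h e * ((if tl e = v then 1 else 0) - (if hd e = v then 1 else 0)) =
      |h e| * ((if flowTail tl hd h e = v then 1 else 0) -
        (if flowHead tl hd h e = v then 1 else 0)) := by
  unfold flowTail flowHead
  by_cases hp : 0 < h e
  · simp only [hp, if_true, abs_of_pos hp]
  · rw [abs_of_nonpos (not_lt.mp hp)]
    simp only [hp, if_false]
    ring

/-- Otherwise flow would enter the head of `e` and none would leave it, so the balance there would
be negative. -/
theorem IsCirculation.exists_next [Fintype E] {tl hd : E → V} {h : E → ℝ} (hc : IsCirculation tl hd h)
    {e : E} (he : h e ≠ 0) : ∃ e', h e' ≠ 0 ∧ flowTail tl hd h e' = flowHead tl hd h e := by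
  by_contra! hno
  have hsum := hc (flowHead tl hd h e)
  simp only [mul_incidence_eq_abs] at hsum
  have hneg : ∑ e', |h e'| * ((if flowTail tl hd h e' = flowHead tl hd h e then (1 : ℝ) else 0) -
      (if flowHead tl hd h e' = flowHead tl hd h e then 1 else 0)) < 0 := by
    refine Finset.sum_neg' (fun e' _ => ?_) ⟨e, Finset.mem_univ e, ?_⟩
    · by_cases h0 : h e' = 0
      · simp [h0]
      · rw [if_neg (hno e' h0)]
        have := abs_nonneg (h e')
        split_ifs <;> linarith
    · rw [if_neg (hno e he), if_pos rfl]
      have := abs_pos.mpr he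
      linarith
  exact hneg.ne hsum

theorem exists_mem_periodicPts {α : Type*} [Finite α] [Nonempty α] (f : α → α) :
    ∃ x, x ∈ f.periodicPts := by
  obtain ⟨x⟩ := ‹Nonempty α›
  obtain ⟨m, n, hne, heq⟩ := Finite.exists_ne_map_eq_of_infinite (fun n : ℕ => f^[n] x)
  wlog hlt : m < n generalizing m n
  · exact this n m hne.symm heq.symm (by omega)
  refine ⟨f^[m] x, n - m, by omega, ?_⟩
  change f^[n - m] (f^[m] x) = f^[m] x
  rw [← Function.iterate_add_apply, Nat.sub_add_cancel hlt.le]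
  exact heq.symm

/-- The support of a nonzero circulation contains a nonempty set of arcs that, traversed in the
direction of the flow, is a union of node-disjoint directed cycles. -/
theorem IsCirculation.exists_cycle [Fintype E] {tl hd : E → V} {h : E → ℝ} (hc : IsCirculation tl hd h)
    (hne : h ≠ 0) :
    ∃ O : Finset E, O.Nonempty ∧ (∀ e ∈ O, h e ≠ 0) ∧
      Set.InjOn (flowTail tl hd h) O ∧ Set.InjOn (flowHead tl hd h) O ∧
      O.image (flowTail tl hd h) = O.image (flowHead tl hd h) := by
  classical
  obtain ⟨e₀, he₀⟩ := Function.ne_iff.mp hne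
  let S := {e : E // h e ≠ 0}
  -- The successor of an arc is chosen as a function of its head alone, so that arcs with a common
  -- head have the same successor. The default `e₀` is never used at the head of an arc of the
  -- support.
  let c : V → S := fun v =>
    if H : ∃ e', h e' ≠ 0 ∧ flowTail tl hd h e' = v then ⟨H.choose, H.choose_spec.1⟩
    else ⟨e₀, he₀⟩
  have hcs : ∀ e : S, flowTail tl hd h (c (flowHead tl hd h e)) = flowHead tl hd h e := by
    intro e
    have H := hc.exists_next e.2
    simp only [c, dif_pos H]
    exact H.choose_spec.2
  let f : S → S := fun e => c (flowHead tl hd h e)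
  have : Nonempty S := ⟨⟨e₀, he₀⟩⟩
  -- The periodic points of the successor map form the required cycles: the map permutes them, which
  -- yields injectivity of tails and heads and equality of the two sets of nodes.
  have hbij := Function.bijOn_periodicPts f
  have hmem : ∀ e, e ∈ (Finset.univ.filter (· ∈ f.periodicPts)).image (Subtype.val : S → E) ↔
      ∃ x : S, x ∈ f.periodicPts ∧ x.1 = e := by
    intro e
    rw [Finset.mem_image]
    exact exists_congr fun x => by rw [Finset.mem_filter_univ]
  refine ⟨(Finset.univ.filter (· ∈ f.periodicPts)).image Subtype.val, ?_, ?_, ?_, ?_, ?_⟩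
  · obtain ⟨x, hx⟩ := exists_mem_periodicPts f
    exact ⟨x.1, (hmem _).mpr ⟨x, hx, rfl⟩⟩
  · intro e he
    obtain ⟨x, -, rfl⟩ := (hmem e).mp he
    exact x.2
  · intro a ha b hb hab
    obtain ⟨x, hx, rfl⟩ := (hmem a).mp ha
    obtain ⟨y, hy, rfl⟩ := (hmem b).mp hb
    obtain ⟨x', hx', rfl⟩ := hbij.surjOn hx
    obtain ⟨y', hy', rfl⟩ := hbij.surjOn hy
    have h1 := hcs x'
    have h2 := hcs y'
    have : flowHead tl hd h x' = flowHead tl hd h y' := by rw [← h1, ← h2]; exact hab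
    simp only [f, this]
  · intro a ha b hb hab
    obtain ⟨x, hx, rfl⟩ := (hmem a).mp ha
    obtain ⟨y, hy, rfl⟩ := (hmem b).mp hb
    have : f x = f y := by simp only [f, hab]
    rw [hbij.injOn hx hy this]
  · ext v
    simp only [Finset.mem_image (s := Finset.image _ _), hmem]
    constructor
    · rintro ⟨_, ⟨x, hx, rfl⟩, rfl⟩
      obtain ⟨x', hx', rfl⟩ := hbij.surjOn hx
      exact ⟨x', ⟨x', hx', rfl⟩, (hcs x').symm⟩
    · rintro ⟨_, ⟨x, hx, rfl⟩, rfl⟩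
      exact ⟨f x, ⟨f x, hbij.mapsTo hx, rfl⟩, hcs x⟩

theorem sum_ite_injOn_image {O : Finset E} {F : E → V} (hF : Set.InjOn F O) (v : V) :
    ∑ e ∈ O, (if F e = v then (1 : ℝ) else 0) = if v ∈ O.image F then 1 else 0 := by
  rw [← Finset.sum_image (f := fun w => if w = v then (1 : ℝ) else 0) hF]
  simp

/-- A nonzero circulation contains a conformal circulation with entries in `{-1, 0, 1}`, in which
at most one arc leaves and at most one arc enters every node. -/
theorem IsCirculation.exists_unit [Fintype E] {tl hd : E → V} {h : E → ℝ} (hc : IsCirculation tl hd h)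
    (hne : h ≠ 0) :
    ∃ w : E → ℝ, w ≠ 0 ∧ IsCirculation tl hd w ∧ (∀ e, w e = 0 ∨ w e = SignType.sign (h e)) ∧
      (∀ e, w e ≠ 0 → h e ≠ 0) ∧
      Set.InjOn (flowTail tl hd w) {e | w e ≠ 0} ∧ Set.InjOn (flowHead tl hd w) {e | w e ≠ 0} := by
  classical
  obtain ⟨O, hO, hsupp, htl, hhd, himg⟩ := hc.exists_cycle hne
  let w : E → ℝ := fun e => if e ∈ O then (SignType.sign (h e) : ℝ) else 0
  have hw : ∀ e, w e ≠ 0 ↔ e ∈ O := by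
    intro e
    by_cases he : e ∈ O
    · rcases lt_or_gt_of_ne (hsupp e he) with hl | hl <;> simp [w, he, hl]
    · simp [w, he]
  have hpos : ∀ e ∈ O, (0 < w e ↔ 0 < h e) := by
    intro e he
    rcases lt_trichotomy (h e) 0 with hl | hl | hl
    · have : ¬ (0 : ℝ) < -1 := by norm_num
      simp [w, he, hl, hl.le, this]
    · exact absurd hl (hsupp e he)
    · simp [w, he, hl]
  have ht : ∀ e ∈ O, flowTail tl hd w e = flowTail tl hd h e := by
    intro e he; simp only [flowTail, hpos e he]
  have hh : ∀ e ∈ O, flowHead tl hd w e = flowHead tl hd h e := by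
    intro e he; simp only [flowHead, hpos e he]
  have habs : ∀ e, |w e| = if e ∈ O then 1 else 0 := by
    intro e
    by_cases he : e ∈ O
    · rcases lt_trichotomy (h e) 0 with hl | hl | hl
      · simp [w, he, hl]
      · exact absurd hl (hsupp e he)
      · simp [w, he, hl]
    · simp [w, he]
  refine ⟨w, ?_, ?_, ?_, fun e he => hsupp e ((hw e).mp he), ?_, ?_⟩
  · obtain ⟨e, he⟩ := hO
    exact fun h0 => (hw e).mpr he (congrFun h0 e)
  · intro v
    -- At each node the balance of `w` is the number of tails minus the number of heads of arcs in
    -- `O`; both are the indicator of the same node set.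
    simp only [mul_incidence_eq_abs, habs, ite_mul, one_mul, zero_mul]
    rw [← Finset.sum_filter, Finset.filter_mem_eq_inter, Finset.univ_inter]
    rw [Finset.sum_congr rfl (g := fun e => (if flowTail tl hd h e = v then (1 : ℝ) else 0) -
      (if flowHead tl hd h e = v then 1 else 0)) (fun e he => by rw [ht e he, hh e he])]
    rw [Finset.sum_sub_distrib, sum_ite_injOn_image htl, sum_ite_injOn_image hhd, himg, sub_self]
  · intro e
    by_cases he : e ∈ O
    · exact Or.inr (by simp [w, he])
    · exact Or.inl (by simp [w, he])
  · intro a ha b hb hab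
    have ha' := (hw a).mp ha
    have hb' := (hw b).mp hb
    rw [ht a ha', ht b hb'] at hab
    exact htl ha' hb' hab
  · intro a ha b hb hab
    have ha' := (hw a).mp ha
    have hb' := (hw b).mp hb
    rw [hh a ha', hh b hb'] at hab
    exact hhd ha' hb' hab

end Circulation

/-! ### Circuits of pseudoflow polyhedra -/

section Pseudoflow

/-- Reversal exchanges `flowTail` and `flowHead`, so `exists_next` also supplies predecessors. -/
theorem IsCirculation.swap {E V : Type*} [DecidableEq V] [Fintype E] {tl hd : E → V} {h : E → ℝ}
    (hc : IsCirculation tl hd h) : IsCirculation hd tl h := by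
  intro v
  refine neg_eq_zero.mp (Eq.trans ?_ (hc v))
  rw [← Finset.sum_neg_distrib]
  exact Finset.sum_congr rfl fun e _ => by ring

theorem IsCirculation.sub_smul {E V : Type*} [DecidableEq V] [Fintype E] {tl hd : E → V}
    {g h : E → ℝ} (hg : IsCirculation tl hd g) (hh : IsCirculation tl hd h) (c : ℝ) :
    IsCirculation tl hd (g - c • h) := by
  intro v
  have h1 := hg v
  have h2 := hh v
  simp only [Pi.sub_apply, Pi.smul_apply, smul_eq_mul, sub_mul, Finset.sum_sub_distrib, mul_assoc,
    ← Finset.mul_sum]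
  rw [h1, h2, mul_zero, sub_zero]

variable {N A : Type*}

/-- The tails of the arcs of the network extended by a root `none`: the slack `s⁺ v` is an arc from
the root to `v`, and `s⁻ v` is an arc from `v` to the root. -/
def rootedTail (G : Network N A) : A ⊕ N ⊕ N → Option N :=
  Sum.elim (fun a => some (G.src a)) (Sum.elim (fun _ => none) some)

/-- The heads of the arcs of the network extended by a root `none`. -/
def rootedHead (G : Network N A) : A ⊕ N ⊕ N → Option N :=
  Sum.elim (fun a => some (G.tgt a)) (Sum.elim some (fun _ => none))

variable [Fintype N] [Fintype A] [DecidableEq N] [DecidableEq A]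

theorem pseudoflowSystem_A_mulVec (G : Network N A) (b : N → ℝ) (u : A → ℝ)
    (h : A ⊕ N ⊕ N → ℝ) (v : N) :
    ((pseudoflowSystem G b u).A *ᵥ h) v =
      ∑ a, ((if G.src a = v then 1 else 0) - (if G.tgt a = v then 1 else 0)) * h (Sum.inl a)
        - h (Sum.inr (Sum.inl v)) + h (Sum.inr (Sum.inr v)) := by
  simp only [pseudoflowSystem, Matrix.fromCols_mulVec, Pi.add_apply, Matrix.neg_mulVec,
    Matrix.one_mulVec, Pi.neg_apply, Function.comp_apply]
  simp only [Matrix.mulVec, dotProduct, Network.incidence, Matrix.of_apply, Function.comp_apply]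
  ring

theorem pseudoflowSystem_A_mulVec_eq_sum (G : Network N A) (b : N → ℝ) (u : A → ℝ)
    (h : A ⊕ N ⊕ N → ℝ) (v : N) :
    ((pseudoflowSystem G b u).A *ᵥ h) v =
      ∑ e, h e * ((if rootedTail G e = some v then 1 else 0) -
        (if rootedHead G e = some v then 1 else 0)) := by
  rw [pseudoflowSystem_A_mulVec]
  simp only [Fintype.sum_sum_type, rootedTail, rootedHead, Sum.elim_inl, Sum.elim_inr,
    Option.some.injEq, reduceCtorEq, if_false]
  rw [Finset.sum_congr rfl fun a _ => mul_comm _ _]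
  simp only [zero_sub, sub_zero, mul_neg, mul_ite, mul_one, mul_zero, Finset.sum_neg_distrib,
    Finset.sum_ite_eq', Finset.mem_univ, if_true]
  ring

/-- The matrix has no row for the root, but conservation there is automatic: each arc has one tail
and one head, so the balances of all nodes add up to zero. -/
theorem isCirculation_iff (G : Network N A) (b : N → ℝ) (u : A → ℝ) (h : A ⊕ N ⊕ N → ℝ) :
    IsCirculation (rootedTail G) (rootedHead G) h ↔ (pseudoflowSystem G b u).A *ᵥ h = 0 := by
  constructor
  · intro hc
    funext v
    rw [pseudoflowSystem_A_mulVec_eq_sum]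
    exact hc (some v)
  · intro h0 v
    have hs : ∀ v : N, ∑ e, h e * ((if rootedTail G e = some v then (1 : ℝ) else 0) -
        (if rootedHead G e = some v then 1 else 0)) = 0 := by
      intro v
      rw [← pseudoflowSystem_A_mulVec_eq_sum G b u, h0, Pi.zero_apply]
    cases v with
    | some v => exact hs v
    | none =>
      have htot : ∑ v : Option N, ∑ e, h e * ((if rootedTail G e = v then (1 : ℝ) else 0) -
          (if rootedHead G e = v then 1 else 0)) = 0 := by
        rw [Finset.sum_comm]
        refine Finset.sum_eq_zero fun e _ => ?_
        rw [← Finset.mul_sum, Finset.sum_sub_distrib]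
        simp
      rw [Fintype.sum_option, Finset.sum_eq_zero (fun v _ => hs v), add_zero] at htot
      exact htot

theorem pseudoflowSystem_B_mulVec_inl (G : Network N A) (b : N → ℝ) (u : A → ℝ)
    (h : A ⊕ N ⊕ N → ℝ) (a : A) :
    ((pseudoflowSystem G b u).B *ᵥ h) (Sum.inl a) = h (Sum.inl a) := by
  simp [pseudoflowSystem, Matrix.fromRows_mulVec, Matrix.fromCols_mulVec]

theorem pseudoflowSystem_B_mulVec_inr (G : Network N A) (b : N → ℝ) (u : A → ℝ)
    (h : A ⊕ N ⊕ N → ℝ) (i : A ⊕ N ⊕ N) :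
    ((pseudoflowSystem G b u).B *ᵥ h) (Sum.inr i) = - h i := by
  simp [pseudoflowSystem, Matrix.fromRows_mulVec, Matrix.neg_mulVec]

/-- The matrix `B` contains a negative identity block, and its capacity rows only repeat arc
coordinates; so minimal support of `B g` means minimal support of `g`. -/
theorem support_B_mulVec_subset_iff (G : Network N A) (b : N → ℝ) (u : A → ℝ)
    (g h : A ⊕ N ⊕ N → ℝ) :
    Function.support ((pseudoflowSystem G b u).B *ᵥ h) ⊆
      Function.support ((pseudoflowSystem G b u).B *ᵥ g) ↔ ∀ i, h i ≠ 0 → g i ≠ 0 := by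
  constructor
  · intro hs i hi
    have := @hs (Sum.inr i)
    simpa [Function.mem_support, pseudoflowSystem_B_mulVec_inr, hi] using this
  · rintro hs (a | i)
    · simpa only [Function.mem_support, pseudoflowSystem_B_mulVec_inl] using hs (Sum.inl a)
    · simpa only [Function.mem_support, pseudoflowSystem_B_mulVec_inr, neg_ne_zero] using hs i

theorem isCircuit_iff (G : Network N A) (b : N → ℝ) (u : A → ℝ) (g : A ⊕ N ⊕ N → ℝ) :
    (pseudoflowSystem G b u).IsCircuit g ↔
      g ≠ 0 ∧ IsCirculation (rootedTail G) (rootedHead G) g ∧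
      (∃ z : A ⊕ N ⊕ N → ℤ, (∀ i, g i = (z i : ℝ)) ∧ Finset.univ.gcd z = 1) ∧
      ∀ h : A ⊕ N ⊕ N → ℝ, h ≠ 0 → IsCirculation (rootedTail G) (rootedHead G) h →
        (∀ i, h i ≠ 0 → g i ≠ 0) → ∀ i, g i ≠ 0 → h i ≠ 0 := by
  simp only [LinearSystem.IsCircuit, isCirculation_iff G b u, Set.Subset.antisymm_iff,
    support_B_mulVec_subset_iff]
  refine and_congr_right fun _ => and_congr_right fun _ => and_congr_right fun _ => ?_
  exact forall_congr' fun h => imp_congr_right fun _ => imp_congr_right fun _ =>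
    ⟨fun H hs => (H hs).2, fun H hs => ⟨hs, H hs⟩⟩

/-- Circuits of pseudoflow polyhedra are incidence vectors of cycles. -/
theorem isCircuit_unit {G : Network N A} {b : N → ℝ} {u : A → ℝ} {g : A ⊕ N ⊕ N → ℝ}
    (hg : (pseudoflowSystem G b u).IsCircuit g) :
    (∀ e, g e = 0 ∨ g e = 1 ∨ g e = -1) ∧
      Set.InjOn (flowTail (rootedTail G) (rootedHead G) g) {e | g e ≠ 0} ∧
      Set.InjOn (flowHead (rootedTail G) (rootedHead G) g) {e | g e ≠ 0} := by
  obtain ⟨hne, hc, ⟨z, hz, hgcd⟩, hmin⟩ := (isCircuit_iff G b u g).mp hg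
  obtain ⟨w, hw0, hwc, hsign, hsupp, htl, hhd⟩ := hc.exists_unit hne
  have hws := hmin w hw0 hwc hsupp
  obtain ⟨e₀, he₀⟩ := Function.ne_iff.mp hw0
  have hwe : ∀ e, w e ≠ 0 → |w e| = 1 ∧ g e = |g e| * w e := by
    intro e he
    have hge := hsupp e he
    rcases hsign e with h | h
    · exact absurd h he
    · rw [h]
      rcases lt_or_gt_of_ne hge with hl | hl
      · simp [hl, abs_of_neg]
      · simp [hl, abs_of_pos]
  -- If this failed, `g - |g e₀| • w` would be a nonzero circulation inside the support of `g` that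
  -- vanishes at `e₀`, against minimality.
  have hprop : g = |g e₀| • w := by
    by_contra hcon
    have hd0 : g - |g e₀| • w ≠ 0 := sub_ne_zero.mpr hcon
    refine hmin (g - |g e₀| • w) hd0 (hc.sub_smul hwc _) ?_ e₀ (hsupp e₀ he₀) ?_
    · intro i hi hgi
      have hwi : w i = 0 := by
        by_contra hwi
        exact hsupp i hwi hgi
      exact hi (by simp [hgi, hwi])
    · have := (hwe e₀ he₀).2
      simp only [Pi.sub_apply, Pi.smul_apply, smul_eq_mul]
      linarith
  -- All entries are now multiples of `|z e₀|`, so coprimality forces `|z e₀| = 1` and `g = w`.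
  have hdvd : |z e₀| ∣ Finset.univ.gcd z := by
    refine Finset.dvd_gcd fun i _ => ?_
    have h1 := congrFun hprop i
    simp only [Pi.smul_apply, smul_eq_mul, hz, ← Int.cast_abs] at h1
    rcases hsign i with h | h
    · rw [h, mul_zero] at h1
      rw [Int.cast_eq_zero.mp h1]
      exact dvd_zero _
    · rw [h] at h1
      refine ⟨SignType.sign (g i), ?_⟩
      have : ((z i : ℤ) : ℝ) = ((|z e₀| * (SignType.sign (g i) : ℤ) : ℤ) : ℝ) := by
        rw [h1]; push_cast
        cases SignType.sign (g i) <;> simp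
      exact_mod_cast this
  rw [hgcd] at hdvd
  have h1 : |z e₀| = 1 := by
    have := Int.isUnit_iff.mp (isUnit_of_dvd_one hdvd)
    have h2 := abs_nonneg (z e₀)
    omega
  have hgw : g = w := by
    rw [hprop, hz, ← Int.cast_abs, h1, Int.cast_one, one_smul]
  subst hgw
  refine ⟨fun e => ?_, htl, hhd⟩
  by_cases he : g e = 0
  · exact Or.inl he
  · exact Or.inr (eq_or_eq_neg_of_abs_eq (hwe e he).1)

/-- The sign with which an arc that leaves the root occurs in a circuit. -/
def rootSign : N ⊕ N → ℝ := Sum.elim (fun _ => 1) (fun _ => -1)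

omit [Fintype N] [Fintype A] [DecidableEq N] [DecidableEq A] in
theorem flowTail_eq_none_iff (G : Network N A) {g : A ⊕ N ⊕ N → ℝ} {e : A ⊕ N ⊕ N}
    (hu : g e = 1 ∨ g e = -1) :
    flowTail (rootedTail G) (rootedHead G) g e = none ↔
      ∃ s, e = Sum.inr s ∧ g e = rootSign s := by
  have h1 : ¬ (0 : ℝ) < -1 := by norm_num
  have h2 : (1 : ℝ) ≠ -1 := by norm_num
  rcases e with a | v | v <;> rcases hu with h | h <;>
    simp [flowTail, rootedTail, rootedHead, rootSign, h, h1, h2, h2.symm]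

omit [Fintype N] [Fintype A] [DecidableEq N] [DecidableEq A] in
theorem flowHead_eq_none_iff (G : Network N A) {g : A ⊕ N ⊕ N → ℝ} {e : A ⊕ N ⊕ N}
    (hu : g e = 1 ∨ g e = -1) :
    flowHead (rootedTail G) (rootedHead G) g e = none ↔
      ∃ s, e = Sum.inr s ∧ g e = - rootSign s := by
  have h1 : ¬ (0 : ℝ) < -1 := by norm_num
  have h2 : (1 : ℝ) ≠ -1 := by norm_num
  rcases e with a | v | v <;> rcases hu with h | h <;>
    simp [flowHead, rootedTail, rootedHead, rootSign, h, h1, h2]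

/-- A circuit of a pseudoflow polyhedron uses no slack variable, or one slack arc that leaves and
one that enters the root. -/
theorem isCircuit_slack {G : Network N A} {b : N → ℝ} {u : A → ℝ} {g : A ⊕ N ⊕ N → ℝ}
    (hg : (pseudoflowSystem G b u).IsCircuit g) :
    (∀ s, g (Sum.inr s) = 0) ∨
      ∃ s s' : N ⊕ N, s ≠ s' ∧ g (Sum.inr s) = rootSign s ∧ g (Sum.inr s') = - rootSign s' ∧
        ∀ s'', s'' ≠ s → s'' ≠ s' → g (Sum.inr s'') = 0 := by
  obtain ⟨hunit, htl, hhd⟩ := isCircuit_unit hg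
  obtain ⟨-, hc, -, -⟩ := (isCircuit_iff G b u g).mp hg
  have hu : ∀ {e}, g e ≠ 0 → g e = 1 ∨ g e = -1 := fun {e} he => (hunit e).resolve_left he
  have hcase : ∀ s, g (Sum.inr s) ≠ 0 →
      g (Sum.inr s) = rootSign s ∨ g (Sum.inr s) = - rootSign s := by
    rintro (v | v) hs
    · exact hu hs
    · simpa [rootSign, or_comm] using hu hs
  have hpm : ∀ s : N ⊕ N, rootSign s = 1 ∨ rootSign s = -1 := by
    rintro (v | v) <;> simp [rootSign]
  by_cases h0 : ∀ s, g (Sum.inr s) = 0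
  · exact Or.inl h0
  right
  push Not at h0
  obtain ⟨c, hc0⟩ := h0
  -- A slack arc through which flow leaves the root has a predecessor that enters it, and
  -- conversely. Injectivity of tails and heads at the root then excludes a third slack arc.
  have key : ∃ s s', g (Sum.inr s) = rootSign s ∧ g (Sum.inr s') = - rootSign s' := by
    rcases hcase c hc0 with h | h
    · obtain ⟨e, he, heq⟩ := hc.swap.exists_next hc0
      change flowHead (rootedTail G) (rootedHead G) g e =
        flowTail (rootedTail G) (rootedHead G) g (Sum.inr c) at heq
      rw [(flowTail_eq_none_iff G (hu hc0)).mpr ⟨c, rfl, h⟩, flowHead_eq_none_iff G (hu he)] at heq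
      obtain ⟨s, rfl, hs⟩ := heq
      exact ⟨c, s, h, hs⟩
    · obtain ⟨e, he, heq⟩ := hc.exists_next hc0
      rw [(flowHead_eq_none_iff G (hu hc0)).mpr ⟨c, rfl, h⟩, flowTail_eq_none_iff G (hu he)] at heq
      obtain ⟨s, rfl, hs⟩ := heq
      exact ⟨s, c, hs, h⟩
  obtain ⟨s, s', hs, hs'⟩ := key
  have hs0 : g (Sum.inr s) ≠ 0 := by rcases hpm s with h | h <;> rw [hs, h] <;> norm_num
  have hs0' : g (Sum.inr s') ≠ 0 := by rcases hpm s' with h | h <;> rw [hs', h] <;> norm_num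
  refine ⟨s, s', ?_, hs, hs', fun s'' h1 h2 => ?_⟩
  · rintro rfl
    rw [hs] at hs'
    rcases hpm s with h | h <;> rw [h] at hs' <;> norm_num at hs'
  · by_contra hne
    rcases hcase s'' hne with h | h
    · refine h1 (Sum.inr_injective (htl hne hs0 ?_))
      rw [(flowTail_eq_none_iff G (hu hne)).mpr ⟨_, rfl, h⟩,
        (flowTail_eq_none_iff G (hu hs0)).mpr ⟨_, rfl, hs⟩]
    · refine h2 (Sum.inr_injective (hhd hne hs0' ?_))
      rw [(flowHead_eq_none_iff G (hu hne)).mpr ⟨_, rfl, h⟩,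
        (flowHead_eq_none_iff G (hu hs0')).mpr ⟨_, rfl, hs'⟩]

end Pseudoflow

/-! ### The assignment polyhedron and its path circuits -/

section Assignment

variable {L T : Type*} [Fintype L] [Fintype T] [DecidableEq L] [DecidableEq T]

theorem assignmentSystem_A_mulVec_person (h : (L × T) ⊕ (L ⊕ T) ⊕ (L ⊕ T) → ℝ) (l : L) :
    ((assignmentSystem L T).A *ᵥ h) (Sum.inl l) =
      ∑ t, h (Sum.inl (l, t)) - h (Sum.inr (Sum.inl (Sum.inl l))) +
        h (Sum.inr (Sum.inr (Sum.inl l))) := by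
  rw [assignmentSystem, pseudoflowSystem_A_mulVec, Fintype.sum_prod_type]
  simp [assignmentNetwork, ite_mul]

theorem assignmentSystem_A_mulVec_task (h : (L × T) ⊕ (L ⊕ T) ⊕ (L ⊕ T) → ℝ) (t : T) :
    ((assignmentSystem L T).A *ᵥ h) (Sum.inr t) =
      -∑ l, h (Sum.inl (l, t)) - h (Sum.inr (Sum.inl (Sum.inr t))) +
        h (Sum.inr (Sum.inr (Sum.inr t))) := by
  rw [assignmentSystem, pseudoflowSystem_A_mulVec, Fintype.sum_prod_type]
  simp [assignmentNetwork, ite_mul]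

theorem assignmentSystem_A_mulVec_eq_zero_iff (h : (L × T) ⊕ (L ⊕ T) ⊕ (L ⊕ T) → ℝ) :
    (assignmentSystem L T).A *ᵥ h = 0 ↔
      (∀ l, ∑ t, h (Sum.inl (l, t)) - h (Sum.inr (Sum.inl (Sum.inl l))) +
        h (Sum.inr (Sum.inr (Sum.inl l))) = 0) ∧
      (∀ t, -∑ l, h (Sum.inl (l, t)) - h (Sum.inr (Sum.inl (Sum.inr t))) +
        h (Sum.inr (Sum.inr (Sum.inr t))) = 0) := by
  simp only [funext_iff, Sum.forall, assignmentSystem_A_mulVec_person,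
    assignmentSystem_A_mulVec_task, Pi.zero_apply]

theorem mem_polyhedron_iff (y : (L × T) ⊕ (L ⊕ T) ⊕ (L ⊕ T) → ℝ) :
    y ∈ (assignmentSystem L T).polyhedron ↔
      ((∀ l, ∑ t, y (Sum.inl (l, t)) - y (Sum.inr (Sum.inl (Sum.inl l))) +
        y (Sum.inr (Sum.inr (Sum.inl l))) = 1) ∧
      (∀ t, -∑ l, y (Sum.inl (l, t)) - y (Sum.inr (Sum.inl (Sum.inr t))) +
        y (Sum.inr (Sum.inr (Sum.inr t))) = -1)) ∧
      (∀ a, y (Sum.inl a) ≤ 1) ∧ ∀ i, 0 ≤ y i := by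
  have hB : (assignmentSystem L T).B *ᵥ y ≤ (assignmentSystem L T).d ↔
      (∀ a, y (Sum.inl a) ≤ 1) ∧ ∀ i, 0 ≤ y i := by
    rw [Pi.le_def, Sum.forall, assignmentSystem]
    simp only [pseudoflowSystem_B_mulVec_inl, pseudoflowSystem_B_mulVec_inr]
    simp only [pseudoflowSystem, Sum.elim_inl, Sum.elim_inr, Pi.zero_apply, neg_nonpos]
  have hA : (assignmentSystem L T).A *ᵥ y = (assignmentSystem L T).b ↔
      ((∀ l, ∑ t, y (Sum.inl (l, t)) - y (Sum.inr (Sum.inl (Sum.inl l))) +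
        y (Sum.inr (Sum.inr (Sum.inl l))) = 1) ∧
      (∀ t, -∑ l, y (Sum.inl (l, t)) - y (Sum.inr (Sum.inl (Sum.inr t))) +
        y (Sum.inr (Sum.inr (Sum.inr t))) = -1)) := by
    rw [funext_iff, Sum.forall]
    simp only [assignmentSystem_A_mulVec_person, assignmentSystem_A_mulVec_task]
    simp only [assignmentSystem, pseudoflowSystem, Sum.elim_inl, Sum.elim_inr]
  rw [LinearSystem.polyhedron, Set.mem_ofPred_eq, hA, hB]

/-- `AugPath S l t p`: the list `p` is a simple path from `l` to the task `t`, alternately with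
arcs outside and inside `S`, and no arc of `S` enters `t`. -/
inductive AugPath (S : Finset (L × T)) : L → T → List (L × T) → Prop
  | last (l : L) (t : T) : (∀ l', (l', t) ∉ S) → AugPath S l t [(l, t)]
  | cons (l : L) (t' : T) (l' : L) (t : T) (p : List (L × T)) :
      (l, t') ∉ S → (l', t') ∈ S → AugPath S l' t p → (∀ a ∈ p, a.1 ≠ l) → (∀ a ∈ p, a.2 ≠ t') →
      AugPath S l t ((l, t') :: (l', t') :: p)

/-! ### Path vectors: signs, node balances and minimality of the support -/

namespace AugPath

variable {S : Finset (L × T)} {l : L} {t : T} {p : List (L × T)}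

omit [Fintype L] [Fintype T] in
theorem pathVector_apply (h : AugPath S l t p) (a : L × T) :
    pathVector p a = if a ∈ p then (if a ∈ S then -1 else 1) else 0 := by
  induction h with
  | last l t hS =>
    by_cases ha : a = (l, t)
    · subst ha; simp [pathVector, hS]
    · simp [pathVector, ha]
  | cons l t' l' t p h1 h2 hp hl ht ih =>
    have hne : (l, t') ≠ (l', t') := fun heq => h1 (heq ▸ h2)
    simp only [pathVector, Pi.sub_apply, ih, List.mem_cons]
    by_cases ha : a = (l, t')
    · subst ha
      have : (l, t') ∉ p := fun hm => hl _ hm rfl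
      simp [this, h1, hne]
    · by_cases hb : a = (l', t')
      · subst hb
        have : (l', t') ∉ p := fun hm => ht _ hm rfl
        simp [this, h2, hne.symm]
      · simp [ha, hb]

omit [Fintype L] in
-- The first two arcs contribute `+1` in row `l` and `-1` in row `l'`; the latter cancels against
-- the rest of the path, which starts at `l'`.
theorem sum_row_pathVector (h : AugPath S l t p) (l₀ : L) :
    ∑ t₀, pathVector p (l₀, t₀) = if l₀ = l then 1 else 0 := by
  induction h with
  | last l t hS =>
    by_cases hl : l₀ = l <;> simp [pathVector, Pi.single_apply, hl]
  | cons l t' l' t p h1 h2 hp hl ht ih =>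
    simp only [pathVector, Pi.sub_apply, Finset.sum_sub_distrib, ih, Pi.single_apply, Prod.mk.injEq,
      ite_and]
    by_cases hl : l₀ = l <;> by_cases hl' : l₀ = l' <;> simp [hl, hl']

omit [Fintype T] in
theorem sum_col_pathVector (h : AugPath S l t p) (t₀ : T) :
    ∑ l₀, pathVector p (l₀, t₀) = if t₀ = t then 1 else 0 := by
  induction h with
  | last l t hS =>
    by_cases hl : t₀ = t <;> simp [pathVector, Pi.single_apply, hl]
  | cons l t' l' t p h1 h2 hp hl ht ih =>
    simp only [pathVector, Pi.sub_apply, Finset.sum_sub_distrib, ih, Pi.single_apply, Prod.mk.injEq]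
    by_cases hl : t₀ = t' <;> simp [hl]

/-- Conservation at the inner nodes forces the values on successive arcs of the path to alternate in
sign. The induction subtracts the flow on the first two arcs and treats the remainder, which lives
on the rest of the path. -/
theorem eq_smul_pathVector (h : AugPath S l t p) {x : L × T → ℝ} (hx : ∀ a, x a ≠ 0 → a ∈ p)
    (hrow : ∀ l₀, l₀ ≠ l → ∑ t₀, x (l₀, t₀) = 0) (hcol : ∀ t₀, t₀ ≠ t → ∑ l₀, x (l₀, t₀) = 0) :
    ∃ c : ℝ, x = c • pathVector p := by
  induction h generalizing x with
  | last l t hS =>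
    refine ⟨x (l, t), funext fun a => ?_⟩
    by_cases ha : a = (l, t)
    · subst ha; simp [pathVector]
    · have : x a = 0 := by
        by_contra h0
        exact ha (by simpa using hx a h0)
      simp [pathVector, ha, this]
  | cons l t' l' t p h1 h2 hp hl ht ih =>
    have hne : (l, t') ≠ (l', t') := fun heq => h1 (heq ▸ h2)
    have hll : l ≠ l' := fun heq => hne (by rw [heq])
    -- The rest of the path has column sum one at its end `t`, but it avoids the column `t'`.
    have htt : t' ≠ t := by
      rintro rfl
      have h3 := hp.sum_col_pathVector t'
      rw [if_pos rfl, Finset.sum_eq_zero] at h3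
      · norm_num at h3
      · intro l₀ _
        rw [hp.pathVector_apply, if_neg]
        exact fun hm => ht _ hm rfl
    have hx0 : ∀ a, a ≠ (l, t') → a ≠ (l', t') → a ∉ p → x a = 0 := by
      intro a h3 h4 h5
      by_contra h0
      simpa [h3, h4, h5] using hx a h0
    have hsum : x (l, t') + x (l', t') = 0 := by
      rw [← hcol t' htt, ← Finset.sum_subset (Finset.subset_univ {l, l'}),
        Finset.sum_pair hll]
      intro l₀ _ hl₀
      simp only [Finset.mem_insert, Finset.mem_singleton, not_or] at hl₀
      refine hx0 _ (by simp [hl₀.1]) (by simp [hl₀.2]) fun hm => ht _ hm rfl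
    set c := x (l, t') with hc
    let d : L × T → ℝ := Pi.single (l, t') 1 - Pi.single (l', t') 1
    have hdrow : ∀ l₀, ∑ t₀, d (l₀, t₀) = (if l₀ = l then 1 else 0) - (if l₀ = l' then 1 else 0) := by
      intro l₀
      simp only [d, Pi.sub_apply, Finset.sum_sub_distrib, Pi.single_apply, Prod.mk.injEq, ite_and]
      by_cases h3 : l₀ = l <;> by_cases h4 : l₀ = l' <;> simp [h3, h4]
    have hdcol : ∀ t₀, ∑ l₀, d (l₀, t₀) = 0 := by
      intro t₀
      simp only [d, Pi.sub_apply, Finset.sum_sub_distrib, Pi.single_apply, Prod.mk.injEq]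
      by_cases h3 : t₀ = t' <;> simp [h3]
    have hz : ∀ a, x a - c * d a ≠ 0 → a ∈ p := by
      intro a ha
      by_contra hap
      apply ha
      by_cases h3 : a = (l, t')
      · subst h3; simp [d, hc, hne]
      · by_cases h4 : a = (l', t')
        · subst h4
          simp only [d, Pi.sub_apply, Pi.single_eq_same, Pi.single_eq_of_ne hne.symm]
          linarith
        · simp [d, h3, h4, hx0 a h3 h4 hap]
    obtain ⟨c', hc'⟩ := ih (x := fun a => x a - c * d a) hz
      (by
        intro l₀ hl₀
        by_cases h3 : l₀ = l
        · refine Finset.sum_eq_zero fun t₀ _ => ?_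
          by_contra h0
          exact hl _ (hz _ h0) h3
        · simp only [Finset.sum_sub_distrib, ← Finset.mul_sum, hrow l₀ h3, hdrow, h3, hl₀]
          simp)
      (by
        intro t₀ ht₀
        simp only [Finset.sum_sub_distrib, ← Finset.mul_sum, hcol t₀ ht₀, hdcol]
        simp)
    -- Conservation in row `l'`, where the two pieces meet, matches their flow values.
    have hcc : c' = c := by
      have h3 := hrow l' hll.symm
      have h4 : ∑ t₀, (x (l', t₀) - c * d (l', t₀)) = ∑ t₀, c' * pathVector p (l', t₀) :=
        Finset.sum_congr rfl fun t₀ _ => congrFun hc' (l', t₀)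
      rw [Finset.sum_sub_distrib, ← Finset.mul_sum, ← Finset.mul_sum, h3, hdrow,
        hp.sum_row_pathVector, if_pos rfl, if_neg hll.symm] at h4
      linarith
    refine ⟨c, funext fun a => ?_⟩
    have h5 := congrFun hc' a
    simp only [pathVector, Pi.smul_apply, Pi.sub_apply, smul_eq_mul, d, hcc] at h5 ⊢
    linarith

end AugPath

theorem Augmentation.circuit_mem_ker {S : Finset (L × T)} {a : Augmentation L T}
    (h : AugPath S a.person a.task a.path) : (assignmentSystem L T).A *ᵥ a.circuit = 0 := by
  rw [assignmentSystem_A_mulVec_eq_zero_iff]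
  constructor
  · intro l
    simp [Augmentation.circuit, h.sum_row_pathVector, Pi.single_apply]
  · intro t
    simp [Augmentation.circuit, h.sum_col_pathVector, Pi.single_apply]

/-- The entry `-1` at the slack of the person gives coprimality. For minimality, a kernel vector
with no larger support is balanced off the endpoints, hence a multiple of the path vector by
`eq_smul_pathVector`, and the endpoint equations fix its slacks. -/
theorem Augmentation.circuit_isCircuit {S : Finset (L × T)} {a : Augmentation L T}
    (h : AugPath S a.person a.task a.path) : (assignmentSystem L T).IsCircuit a.circuit := by
  have hker := Augmentation.circuit_mem_ker h
  have hperson : a.circuit (Sum.inr (Sum.inr (Sum.inl a.person))) = -1 := by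
    simp [Augmentation.circuit]
  have hiff := isCircuit_iff (assignmentNetwork L T) (Sum.elim (fun _ => 1) (fun _ => -1))
    (fun _ => 1) a.circuit
  simp only [isCirculation_iff (b := Sum.elim (fun _ => 1) (fun _ => -1)) (u := fun _ => 1)] at hiff
  refine hiff.mpr ⟨fun h0 => ?_, hker, ?_, ?_⟩
  · rw [h0] at hperson
    norm_num at hperson
  · refine ⟨Sum.elim (fun e => if e ∈ a.path then (if e ∈ S then -1 else 1) else 0)
      (Sum.elim (-Pi.single (Sum.inr a.task) 1) (-Pi.single (Sum.inl a.person) 1)), ?_, ?_⟩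
    · rintro (e | v | v)
      · simp [Augmentation.circuit, h.pathVector_apply]
      · simp [Augmentation.circuit, Pi.single_apply, apply_ite]
      · simp [Augmentation.circuit, Pi.single_apply, apply_ite]
    · rw [← Finset.normalize_gcd, normalize_eq_one]
      refine isUnit_of_dvd_unit
        (Finset.gcd_dvd (Finset.mem_univ (Sum.inr (Sum.inr (Sum.inl a.person))))) ?_
      simp
  · intro g hg0 hg hsupp
    obtain ⟨hrow, hcol⟩ := (assignmentSystem_A_mulVec_eq_zero_iff g).mp hg
    have hzero : ∀ i, a.circuit i = 0 → g i = 0 := fun i hi => by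
      by_contra hne
      exact hsupp i hne hi
    have h1 : ∀ l, g (Sum.inr (Sum.inl (Sum.inl l))) = 0 := fun l =>
      hzero _ (by simp [Augmentation.circuit])
    have h2 : ∀ t, g (Sum.inr (Sum.inr (Sum.inr t))) = 0 := fun t =>
      hzero _ (by simp [Augmentation.circuit])
    have h3 : ∀ l, l ≠ a.person → g (Sum.inr (Sum.inr (Sum.inl l))) = 0 := fun l hl =>
      hzero _ (by simp [Augmentation.circuit, hl])
    have h4 : ∀ t, t ≠ a.task → g (Sum.inr (Sum.inl (Sum.inr t))) = 0 := fun t ht =>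
      hzero _ (by simp [Augmentation.circuit, ht])
    obtain ⟨c, hc⟩ := h.eq_smul_pathVector (x := fun e => g (Sum.inl e))
      (fun e he => by
        by_contra hne
        exact he (hzero _ (by simp [Augmentation.circuit, h.pathVector_apply, hne])))
      (fun l hl => by have := hrow l; rw [h1, h3 l hl] at this; linarith)
      (fun t ht => by have := hcol t; rw [h2, h4 t ht] at this; linarith)
    have hcx : ∀ e, g (Sum.inl e) = c * pathVector a.path e := fun e => congrFun hc e
    have hgc : g = c • a.circuit := by
      funext i
      rcases i with e | (l | t) | (l | t)
      · simpa [Augmentation.circuit] using hcx e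
      · simpa [Augmentation.circuit] using h1 l
      · by_cases ht : t = a.task
        · have := hcol t
          simp only [hcx, ← Finset.mul_sum, h.sum_col_pathVector, h2, ht] at this
          simp only [Augmentation.circuit, ht, Pi.smul_apply, Sum.elim_inr, Sum.elim_inl,
            Pi.neg_apply, Pi.single_eq_same, smul_eq_mul]
          simp only [if_true] at this
          linarith
        · simpa [Augmentation.circuit, ht] using h4 t ht
      · by_cases hl : l = a.person
        · have := hrow l
          simp only [hcx, ← Finset.mul_sum, h.sum_row_pathVector, h1, hl] at this
          simp only [Augmentation.circuit, hl, Pi.smul_apply, Sum.elim_inr,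
            Pi.neg_apply, Pi.single_eq_same, smul_eq_mul]
          simp only [if_true] at this
          linarith
        · simpa [Augmentation.circuit, hl] using h3 l hl
      · simpa [Augmentation.circuit] using h2 t
    have hc0 : c ≠ 0 := by
      rintro rfl
      exact hg0 (by rw [hgc, zero_smul])
    intro i hi
    rw [hgc]
    exact mul_ne_zero hc0 hi

end Assignment

/-! ### Dantzig's rule at the points of partial matchings -/

section Stage

variable {L T : Type*} [Fintype L] [Fintype T] [DecidableEq L] [DecidableEq T]

/-- Every person and every task occurs exactly once in the list of augmentations. -/
structure IsCompleteOrder (r : List (Augmentation L T)) : Prop where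
  nodup_person : (r.map Augmentation.person).Nodup
  nodup_task : (r.map Augmentation.task).Nodup
  mem_person : ∀ l, l ∈ r.map Augmentation.person
  mem_task : ∀ t, t ∈ r.map Augmentation.task

/-- The coefficient of `-2 D` in the objective on the slack variables. -/
noncomputable def slackWeight (r : List (Augmentation L T)) : (L ⊕ T) ⊕ (L ⊕ T) → ℝ :=
  Sum.elim
    (fun v => ∑ i : Fin r.length,
      ((i : ℕ) + 1 : ℝ) * (Pi.single (Sum.inr r[i].task) 1 : L ⊕ T → ℝ) v)
    (fun v => ∑ i : Fin r.length,
      ((i : ℕ) + 1 : ℝ) * (Pi.single (Sum.inl r[i].person) 1 : L ⊕ T → ℝ) v)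

theorem objective_inr (C : Matrix L T ℝ) (M : ℝ) (r : List (Augmentation L T))
    (s : (L ⊕ T) ⊕ (L ⊕ T)) :
    objective C M r (Sum.inr s) = M - 2 * costBound C * slackWeight r s := by
  rcases s with v | v <;> rfl

/-- The slack variables of a point that matches the pairs of the first `k` augmentations. -/
noncomputable def stageSlack (r : List (Augmentation L T)) (k : ℕ) : (L ⊕ T) ⊕ (L ⊕ T) → ℝ :=
  Sum.elim
    (Sum.elim (fun _ => 0) (fun t => if t ∈ (r.take k).map Augmentation.task then 0 else 1))
    (Sum.elim (fun l => if l ∈ (r.take k).map Augmentation.person then 0 else 1) (fun _ => 0))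

/-- The slack variables of a path circuit. -/
noncomputable def pairSlack (a : Augmentation L T) : (L ⊕ T) ⊕ (L ⊕ T) → ℝ :=
  Sum.elim (-Pi.single (Sum.inr a.task) 1) (-Pi.single (Sum.inl a.person) 1)

/-- A `0/1`-point of the polyhedron that matches the persons and tasks of the first `k`
augmentations. -/
structure IsStage (r : List (Augmentation L T)) (k : ℕ)
    (y : (L × T) ⊕ (L ⊕ T) ⊕ (L ⊕ T) → ℝ) : Prop where
  mem : y ∈ (assignmentSystem L T).polyhedron
  binary : ∀ i, y i = 0 ∨ y i = 1
  slack : ∀ s, y (Sum.inr s) = stageSlack r k s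

/-! ### Positions in the run, slack weights and the cost of a circuit -/

omit [Fintype L] [Fintype T] [DecidableEq L] [DecidableEq T] in
theorem getElem_inj_of_nodup_map {α β : Type*} {f : α → β} {r : List α} (h : (r.map f).Nodup)
    {i j : ℕ} (hi : i < r.length) (hj : j < r.length) (hij : f r[i] = f r[j]) : i = j := by
  refine (List.Nodup.getElem_inj_iff h (hi := by simpa) (hj := by simpa)).mp ?_
  simpa using hij

theorem sum_index_mul_single {α β : Type*} [DecidableEq β] {f : α → β} {r : List α}
    (h : (r.map f).Nodup) {j : ℕ} (hj : j < r.length) :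
    ∑ i : Fin r.length, ((i : ℕ) + 1 : ℝ) * (Pi.single (f r[i]) 1 : β → ℝ) (f r[j]) = j + 1 := by
  rw [Finset.sum_eq_single ⟨j, hj⟩]
  · simp
  · intro i _ hi
    rw [Pi.single_eq_of_ne, mul_zero]
    intro heq
    exact hi (Fin.ext (getElem_inj_of_nodup_map h i.2 hj heq.symm))
  · simp

theorem exists_index_ge {α β : Type*} {f : α → β} {r : List α} {b : β} {k : ℕ}
    (hb : b ∈ r.map f) (hk : b ∉ (r.take k).map f) :
    ∃ j, ∃ hj : j < r.length, k ≤ j ∧ f r[j] = b := by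
  obtain ⟨a, ha, rfl⟩ := List.mem_map.mp hb
  obtain ⟨j, hj, rfl⟩ := List.getElem_of_mem ha
  refine ⟨j, hj, ?_, rfl⟩
  by_contra hlt
  push Not at hlt
  refine hk (List.mem_map.mpr ⟨r[j], ?_, rfl⟩)
  exact List.mem_take_iff_getElem.mpr ⟨j, by omega, rfl⟩

theorem notMem_take_map {α β : Type*} {f : α → β} {r : List α} (h : (r.map f).Nodup) {k : ℕ}
    (hk : k < r.length) : f r[k] ∉ (r.take k).map f := by
  intro hmem
  obtain ⟨a, ha, hfa⟩ := List.mem_map.mp hmem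
  obtain ⟨j, hj, rfl⟩ := List.mem_take_iff_getElem.mp ha
  have := getElem_inj_of_nodup_map h (by omega) hk hfa
  omega

omit [Fintype L] [Fintype T] in
theorem slackWeight_task {r : List (Augmentation L T)} (hr : IsCompleteOrder r) {j : ℕ}
    (hj : j < r.length) : slackWeight r (Sum.inl (Sum.inr r[j].task)) = j + 1 := by
  rw [← sum_index_mul_single hr.nodup_task hj]
  simp [slackWeight, Pi.single_apply]

omit [Fintype L] [Fintype T] in
theorem slackWeight_person {r : List (Augmentation L T)} (hr : IsCompleteOrder r) {j : ℕ}
    (hj : j < r.length) : slackWeight r (Sum.inr (Sum.inl r[j].person)) = j + 1 := by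
  rw [← sum_index_mul_single hr.nodup_person hj]
  simp [slackWeight, Pi.single_apply]

omit [Fintype L] [Fintype T] in
theorem slackWeight_le {r : List (Augmentation L T)} (hr : IsCompleteOrder r)
    (s : (L ⊕ T) ⊕ (L ⊕ T)) : slackWeight r s ≤ r.length := by
  have hbound : ∀ j, j < r.length → (j : ℝ) + 1 ≤ r.length := fun j hj => by exact_mod_cast hj
  rcases s with (l | t) | (l | t)
  · simp [slackWeight]
  · obtain ⟨j, hj, -, rfl⟩ := exists_index_ge (k := 0) (hr.mem_task t) (by simp)
    rw [slackWeight_task hr hj]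
    exact hbound j hj
  · obtain ⟨j, hj, -, rfl⟩ := exists_index_ge (k := 0) (hr.mem_person l) (by simp)
    rw [slackWeight_person hr hj]
    exact hbound j hj
  · simp [slackWeight]

omit [DecidableEq L] [DecidableEq T] in
theorem costBound_pos (C : Matrix L T ℝ) : 1 ≤ costBound C := by
  unfold costBound
  have : 0 ≤ ∑ a : L × T, |C a.1 a.2| := Finset.sum_nonneg fun _ _ => abs_nonneg _
  linarith

omit [DecidableEq L] [DecidableEq T] in
-- The arc costs of two circuits differ by at most `2(D - 1)`, strictly less than the step `2D`
-- between consecutive slack weights; this is the purpose of the summand `1` in `D`.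
theorem abs_sum_cost_le (C : Matrix L T ℝ) {x : L × T → ℝ}
    (hx : ∀ a, x a = 0 ∨ x a = 1 ∨ x a = -1) :
    |∑ a : L × T, C a.1 a.2 * x a| ≤ costBound C - 1 := by
  unfold costBound
  rw [add_sub_cancel_left]
  refine (Finset.abs_sum_le_sum_abs _ _).trans (Finset.sum_le_sum fun a _ => ?_)
  rw [abs_mul]
  rcases hx a with h | h | h <;> simp [h]

theorem objective_dotProduct (C : Matrix L T ℝ) (M : ℝ) (r : List (Augmentation L T))
    (h : (L × T) ⊕ (L ⊕ T) ⊕ (L ⊕ T) → ℝ) :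
    objective C M r ⬝ᵥ h = ∑ a : L × T, C a.1 a.2 * h (Sum.inl a) +
      ∑ s, (M - 2 * costBound C * slackWeight r s) * h (Sum.inr s) := by
  rw [dotProduct, Fintype.sum_sum_type]
  simp only [objective_inr]
  rfl

theorem objective_dotProduct_of_pairSlack {C : Matrix L T ℝ} {M : ℝ}
    {r : List (Augmentation L T)} (hr : IsCompleteOrder r) {k : ℕ} (hk : k < r.length)
    {h : (L × T) ⊕ (L ⊕ T) ⊕ (L ⊕ T) → ℝ} (hs : ∀ s, h (Sum.inr s) = pairSlack r[k] s) :
    objective C M r ⬝ᵥ h = ∑ a : L × T, C a.1 a.2 * h (Sum.inl a) +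
      (-2 * M + 4 * costBound C * (k + 1)) := by
  have e1 := slackWeight_task hr hk
  have e2 := slackWeight_person hr hk
  rw [objective_dotProduct]
  congr 1
  simp only [hs, pairSlack, Fintype.sum_sum_type, Sum.elim_inl, Sum.elim_inr, Pi.neg_apply,
    Pi.single_apply, mul_neg, mul_ite, mul_one, mul_zero, Finset.sum_neg_distrib,
    Finset.sum_ite_eq', Finset.mem_univ, if_true, e1, e2]
  ring

theorem sign_of_isFeasibleCircuit
    {y h : (L × T) ⊕ (L ⊕ T) ⊕ (L ⊕ T) → ℝ}
    (hh : (assignmentSystem L T).IsFeasibleCircuit y h) :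
    (∀ i, y i = 0 → 0 ≤ h i) ∧ ∀ a, y (Sum.inl a) = 1 → h (Sum.inl a) ≤ 0 := by
  obtain ⟨-, α, hα, hmem⟩ := hh
  obtain ⟨-, h1, h0⟩ := (mem_polyhedron_iff _).mp hmem
  constructor
  · intro i hi
    have := h0 i
    simp only [Pi.add_apply, Pi.smul_apply, smul_eq_mul, hi, zero_add] at this
    exact nonneg_of_mul_nonneg_right this hα
  · intro a ha
    have := h1 a
    simp only [Pi.add_apply, Pi.smul_apply, smul_eq_mul, ha] at this
    by_contra hcon
    push Not at hcon
    have := mul_pos hα hcon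
    linarith

theorem sum_mul_of_pair {ι : Type*} [Fintype ι] [DecidableEq ι] {f g : ι → ℝ} {s s' : ι}
    (hne : s ≠ s') (h0 : ∀ i, i ≠ s → i ≠ s' → g i = 0) :
    ∑ i, f i * g i = f s * g s + f s' * g s' := by
  rw [← Finset.sum_pair (f := fun i => f i * g i) hne]
  refine (Finset.sum_subset (Finset.subset_univ _) fun i _ hi => ?_).symm
  simp only [Finset.mem_insert, Finset.mem_singleton, not_or] at hi
  rw [h0 i hi.1 hi.2, mul_zero]

/-- The slack part of the objective of a circuit, by the kind of its two slack arcs. -/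
theorem IsStage.slack_cases {r : List (Augmentation L T)} (hr : IsCompleteOrder r) {k : ℕ}
    {y h : (L × T) ⊕ (L ⊕ T) ⊕ (L ⊕ T) → ℝ} (hy : IsStage r k y) {C : Matrix L T ℝ} {M : ℝ}
    (hh : (assignmentSystem L T).IsFeasibleCircuit y h)
    (hM : 10 * costBound C * (r.length + 1) ≤ M) :
    (∀ s, h (Sum.inr s) = 0) ∨
    -(2 * costBound C * r.length) ≤
      ∑ s, (M - 2 * costBound C * slackWeight r s) * h (Sum.inr s) ∧
        (k = r.length → 2 * (M - 2 * costBound C * r.length) ≤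
          ∑ s, (M - 2 * costBound C * slackWeight r s) * h (Sum.inr s)) ∨
    ∃ (i j : ℕ) (hi : i < r.length) (hj : j < r.length), k ≤ i ∧ k ≤ j ∧
      (∀ s, h (Sum.inr s) = pairSlack ⟨r[i].person, r[j].task, []⟩ s) ∧
      ∑ s, (M - 2 * costBound C * slackWeight r s) * h (Sum.inr s) =
        -2 * M + 2 * costBound C * ((i + 1) + (j + 1)) := by
  have hD := costBound_pos C
  have hslackcost : ∀ s, M - 2 * costBound C * r.length ≤
      M - 2 * costBound C * slackWeight r s := by
    intro s
    have := mul_le_mul_of_nonneg_left (slackWeight_le hr s)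
      (show (0 : ℝ) ≤ 2 * costBound C by linarith)
    linarith
  have hn : (0 : ℝ) ≤ costBound C * r.length := by positivity
  have hMn : 2 * costBound C * r.length ≤ M := by nlinarith
  obtain ⟨hsign, -⟩ := sign_of_isFeasibleCircuit hh
  rcases isCircuit_slack hh.1 with h0 | ⟨s, s', hne, hs, hs', hz⟩
  · exact Or.inl h0
  right
  -- Only positive slacks can decrease: `s⁻` at unmatched persons and `s⁺` at unmatched tasks.
  have hneg : ∀ s, h (Sum.inr s) < 0 → stageSlack r k s ≠ 0 := by
    intro s hlt heq
    have := hsign (Sum.inr s) (by rw [hy.slack, heq])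
    linarith
  -- The arc leaving the root either increases some `s⁺`, which costs almost `M`, or decreases some
  -- `s⁻`, necessarily at an unmatched person. The arc entering the root is treated symmetrically
  -- below.
  have hleave : (M - 2 * costBound C * r.length ≤
        (M - 2 * costBound C * slackWeight r s) * h (Sum.inr s)) ∨
      ∃ (i : ℕ) (hi : i < r.length), k ≤ i ∧ s = Sum.inr (Sum.inl r[i].person) ∧
        h (Sum.inr s) = -1 ∧ slackWeight r s = i + 1 := by
    rcases s with v | v
    · left
      rw [hs]
      simpa [rootSign] using hslackcost (Sum.inl v)
    · right
      have hm1 : h (Sum.inr (Sum.inr v)) = -1 := by rw [hs]; rfl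
      have hst := hneg (Sum.inr v) (by rw [hm1]; norm_num)
      rcases v with l | t
      · simp only [stageSlack, Sum.elim_inr, Sum.elim_inl, ne_eq, ite_eq_left_iff,
          one_ne_zero, imp_false, not_not] at hst
        obtain ⟨i, hi, hki, rfl⟩ := exists_index_ge (hr.mem_person l) hst
        exact ⟨i, hi, hki, rfl, hm1, slackWeight_person hr hi⟩
      · simp [stageSlack] at hst
  have henter : (M - 2 * costBound C * r.length ≤
        (M - 2 * costBound C * slackWeight r s') * h (Sum.inr s')) ∨
      ∃ (j : ℕ) (hj : j < r.length), k ≤ j ∧ s' = Sum.inl (Sum.inr r[j].task) ∧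
        h (Sum.inr s') = -1 ∧ slackWeight r s' = j + 1 := by
    rcases s' with v | v
    · right
      have hm1 : h (Sum.inr (Sum.inl v)) = -1 := by rw [hs']; rfl
      have hst := hneg (Sum.inl v) (by rw [hm1]; norm_num)
      rcases v with l | t
      · simp [stageSlack] at hst
      · simp only [stageSlack, Sum.elim_inr, Sum.elim_inl, ne_eq, ite_eq_left_iff,
          one_ne_zero, imp_false, not_not] at hst
        obtain ⟨j, hj, hkj, rfl⟩ := exists_index_ge (hr.mem_task t) hst
        exact ⟨j, hj, hkj, rfl, hm1, slackWeight_task hr hj⟩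
    · left
      rw [hs']
      simpa [rootSign] using hslackcost (Sum.inr v)
  rw [sum_mul_of_pair hne hz]
  have hle : ∀ i : ℕ, (0 : ℝ) ≤ 2 * costBound C * (i + 1) := fun i => by positivity
  -- Two increases cost about `2M`; in the mixed cases `M` cancels; two decreases match a new pair.
  -- A decrease needs an index between `k` and `r.length`, so for `k = r.length` only two increases
  -- remain.
  rcases hleave with h1 | ⟨i, hi, hki, rfl, hsi, hwi⟩ <;>
    rcases henter with h2 | ⟨j, hj, hkj, rfl, hsj, hwj⟩
  · left
    refine ⟨by nlinarith, fun _ => by linarith⟩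
  · left
    rw [hsj, hwj]
    exact ⟨by linarith [hle j], fun hk => by omega⟩
  · left
    rw [hsi, hwi]
    exact ⟨by linarith [hle i], fun hk => by omega⟩
  · right
    refine ⟨i, j, hi, hj, hki, hkj, fun s => ?_, ?_⟩
    · by_cases h1 : s = Sum.inr (Sum.inl r[i].person)
      · rw [h1, hsi]; simp [pairSlack]
      · by_cases h2 : s = Sum.inl (Sum.inr r[j].task)
        · rw [h2, hsj]; simp [pairSlack]
        · rw [hz s h1 h2]
          rcases s with (l | t) | (l | t)
          · simp [pairSlack]
          · have : t ≠ r[j].task := fun heq => h2 (by rw [heq])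
            simp [pairSlack, this]
          · have : l ≠ r[i].person := fun heq => h1 (by rw [heq])
            simp [pairSlack, this]
          · simp [pairSlack]
    · rw [hsi, hsj, hwi, hwj]
      ring

/-- Feasible circuits at a stage either match the next pair or are much more expensive. -/
theorem IsStage.pairSlack_or_lt {r : List (Augmentation L T)} (hr : IsCompleteOrder r) {k : ℕ}
    (hk : k < r.length) {y h : (L × T) ⊕ (L ⊕ T) ⊕ (L ⊕ T) → ℝ} (hy : IsStage r k y)
    {C : Matrix L T ℝ} {M : ℝ} (hh : (assignmentSystem L T).IsFeasibleCircuit y h)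
    (hM : 10 * costBound C * (r.length + 1) ≤ M) :
    (∀ s, h (Sum.inr s) = pairSlack r[k] s) ∨
      -2 * M + 4 * costBound C * (k + 1) + (costBound C - 1) < objective C M r ⬝ᵥ h := by
  have hD := costBound_pos C
  have hx := abs_le.mp (abs_sum_cost_le C (fun a => (isCircuit_unit hh.1).1 (Sum.inl a)))
  have hkn : costBound C * (k + 1) ≤ costBound C * r.length :=
    mul_le_mul_of_nonneg_left (by exact_mod_cast hk) (by linarith)
  have hn : (0 : ℝ) ≤ costBound C * r.length := by positivity
  rw [objective_dotProduct]
  rcases hy.slack_cases hr hh hM with h0 | ⟨hle, -⟩ | ⟨i, j, hi, hj, hki, hkj, hs, hsum⟩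
  · right
    simp only [h0, mul_zero, Finset.sum_const_zero, add_zero]
    nlinarith
  · right
    nlinarith
  · rw [hsum]
    -- Since `i, j ≥ k`, any other choice has `i + j ≥ 2k + 1`. The extra `2D` exceeds both `D - 1`
    -- in the threshold and the possible gain `D - 1` on the arcs together.
    by_cases hij : i = k ∧ j = k
    · obtain ⟨rfl, rfl⟩ := hij
      exact Or.inl hs
    · right
      have : (2 * k + 1 : ℝ) ≤ i + j := by
        have : 2 * k + 1 ≤ i + j := by omega
        exact_mod_cast this
      have := mul_le_mul_of_nonneg_left this (show (0 : ℝ) ≤ 2 * costBound C by linarith)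
      linarith

/-- At a `0/1`-point a unit step along a vector with entries in `{-1, 0, 1}` violates no bound if
the signs are right at the tight bounds. Only arcs have upper bounds, hence the second sign
condition. -/
theorem IsStage.add_mem {r : List (Augmentation L T)} {k : ℕ}
    {y h : (L × T) ⊕ (L ⊕ T) ⊕ (L ⊕ T) → ℝ} (hy : IsStage r k y)
    (hker : (assignmentSystem L T).A *ᵥ h = 0) (hu : ∀ i, h i = 0 ∨ h i = 1 ∨ h i = -1)
    (h0 : ∀ i, y i = 0 → 0 ≤ h i) (h1 : ∀ a, y (Sum.inl a) = 1 → h (Sum.inl a) ≤ 0) :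
    y + h ∈ (assignmentSystem L T).polyhedron := by
  obtain ⟨hA, hB⟩ := hy.mem
  obtain ⟨-, hle, hnn⟩ := (mem_polyhedron_iff y).mp hy.mem
  have hmem : (assignmentSystem L T).A *ᵥ (y + h) = (assignmentSystem L T).b := by
    rw [Matrix.mulVec_add, hA, hker, add_zero]
  refine ⟨hmem, ?_⟩
  rw [Pi.le_def, Sum.forall, assignmentSystem]
  simp only [pseudoflowSystem_B_mulVec_inl, pseudoflowSystem_B_mulVec_inr]
  simp only [pseudoflowSystem, Sum.elim_inl, Sum.elim_inr, Pi.zero_apply, neg_nonpos, Pi.add_apply]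
  constructor
  · intro a
    rcases hy.binary (Sum.inl a) with h2 | h2
    · rcases hu (Sum.inl a) with h3 | h3 | h3 <;> rw [h2, h3] <;> norm_num
    · have := h1 a h2
      linarith
  · intro i
    rcases hy.binary i with h2 | h2
    · have := h0 i h2
      linarith
    · rcases hu i with h3 | h3 | h3 <;> rw [h2, h3] <;> norm_num

omit [Fintype L] [Fintype T] in
theorem stageSlack_succ {r : List (Augmentation L T)} (hr : IsCompleteOrder r) {k : ℕ}
    (hk : k < r.length) (s : (L ⊕ T) ⊕ (L ⊕ T)) :
    stageSlack r (k + 1) s = stageSlack r k s + pairSlack r[k] s := by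
  have h1 := notMem_take_map hr.nodup_person hk
  have h2 := notMem_take_map hr.nodup_task hk
  rcases s with (l | t) | (l | t)
  · simp [stageSlack, pairSlack]
  · simp only [stageSlack, pairSlack, Sum.elim_inl, Sum.elim_inr, List.take_succ_eq_append_getElem hk,
      List.map_append, List.map_cons, List.map_nil, List.mem_append, List.mem_singleton,
      Pi.neg_apply, Pi.single_apply, Sum.inr.injEq]
    by_cases ht : t = r[k].task
    · simp [ht, h2, -List.map_take]
    · simp [ht]
  · simp only [stageSlack, pairSlack, Sum.elim_inl, Sum.elim_inr, List.take_succ_eq_append_getElem hk,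
      List.map_append, List.map_cons, List.map_nil, List.mem_append, List.mem_singleton,
      Pi.neg_apply, Pi.single_apply, Sum.inl.injEq]
    by_cases hl : l = r[k].person
    · simp [hl, h1, -List.map_take]
    · simp [hl]
  · simp [stageSlack, pairSlack]

/-- A unit step along a circuit that matches the next pair leads to the next stage, and it is
maximal. -/
theorem IsStage.add {r : List (Augmentation L T)} (hr : IsCompleteOrder r) {k : ℕ}
    (hk : k < r.length) {y h : (L × T) ⊕ (L ⊕ T) ⊕ (L ⊕ T) → ℝ} (hy : IsStage r k y)
    (hh : (assignmentSystem L T).IsFeasibleCircuit y h)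
    (hs : ∀ s, h (Sum.inr s) = pairSlack r[k] s) :
    IsStage r (k + 1) (y + h) ∧
      ∀ β : ℝ, 1 < β → y + β • h ∉ (assignmentSystem L T).polyhedron := by
  obtain ⟨h0, h1⟩ := sign_of_isFeasibleCircuit hh
  have hu := (isCircuit_unit hh.1).1
  have hslack : ∀ s, (y + h) (Sum.inr s) = stageSlack r (k + 1) s := fun s => by
    rw [stageSlack_succ hr hk, ← hs, ← hy.slack, Pi.add_apply]
  refine ⟨⟨hy.add_mem hh.1.2.1 hu h0 h1, ?_, hslack⟩, ?_⟩
  · rintro (a | s)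
    · rw [Pi.add_apply]
      rcases hy.binary (Sum.inl a) with h2 | h2
      · have h4 := h0 _ h2
        rcases hu (Sum.inl a) with h3 | h3 | h3 <;> rw [h3] at h4 <;> rw [h2, h3] <;>
          first | (norm_num; done) | linarith
      · have h4 := h1 _ h2
        rcases hu (Sum.inl a) with h3 | h3 | h3 <;> rw [h3] at h4 <;> rw [h2, h3] <;>
          first | (norm_num; done) | linarith
    · rw [hslack]
      rcases s with (l | t) | (l | t) 
      · exact Or.inl rfl
      · exact ite_eq_or_eq _ _ _
      · exact ite_eq_or_eq _ _ _
      · exact Or.inl rfl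
  -- Beyond length one, the slack `s⁻` of the newly matched person would be `1 - β < 0`.
  · intro β hβ hmem
    have h2 := ((mem_polyhedron_iff _).mp hmem).2.2 (Sum.inr (Sum.inr (Sum.inl r[k].person)))
    rw [Pi.add_apply, Pi.smul_apply, hs, hy.slack] at h2
    have h3 := notMem_take_map hr.nodup_person hk
    simp only [stageSlack, Sum.elim_inr, Sum.elim_inl, h3, if_false, pairSlack, Pi.neg_apply,
      Pi.single_eq_same, smul_eq_mul] at h2
    linarith

theorem IsStage.eq_add_of_isMaximalStep {r : List (Augmentation L T)} (hr : IsCompleteOrder r)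
    {k : ℕ} (hk : k < r.length) {y h y' : (L × T) ⊕ (L ⊕ T) ⊕ (L ⊕ T) → ℝ} (hy : IsStage r k y)
    (hh : (assignmentSystem L T).IsFeasibleCircuit y h)
    (hs : ∀ s, h (Sum.inr s) = pairSlack r[k] s)
    (hstep : (assignmentSystem L T).IsMaximalStep y h y') : y' = y + h := by
  obtain ⟨α, -, rfl, hmem, hmax⟩ := hstep
  obtain ⟨hst, hgt⟩ := hy.add hr hk hh hs
  rcases lt_trichotomy α 1 with hlt | rfl | hlt
  · exact absurd (by rw [one_smul]; exact hst.mem) (hmax 1 hlt)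
  · rw [one_smul]
  · exact absurd hmem (hgt α hlt)

/-- The circuit with the single arc between the next person and the next task is feasible. -/
theorem IsStage.exists_feasible {r : List (Augmentation L T)} (hr : IsCompleteOrder r) {k : ℕ}
    (hk : k < r.length) {y : (L × T) ⊕ (L ⊕ T) ⊕ (L ⊕ T) → ℝ} (hy : IsStage r k y) :
    ∃ h, (assignmentSystem L T).IsFeasibleCircuit y h ∧
      ∀ s, h (Sum.inr s) = pairSlack r[k] s := by
  let a : Augmentation L T := ⟨r[k].person, r[k].task, [(r[k].person, r[k].task)]⟩
  -- Being a circuit does not depend on the matching, so the empty matching may be used to certify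
  -- the single arc.
  have hpath : AugPath ∅ a.person a.task a.path := AugPath.last _ _ (by simp)
  have hcirc := Augmentation.circuit_isCircuit hpath
  have h1 := notMem_take_map hr.nodup_person hk
  have h2 := notMem_take_map hr.nodup_task hk
  -- The slack of the unmatched person already accounts for the whole supply, so all arcs in its row
  -- carry zero.
  have hx : y (Sum.inl (r[k].person, r[k].task)) = 0 := by
    obtain ⟨⟨hrow, -⟩, -, hnn⟩ := (mem_polyhedron_iff y).mp hy.mem
    have := hrow r[k].person
    rw [hy.slack, hy.slack] at this
    simp only [stageSlack, Sum.elim_inr, Sum.elim_inl, h1, if_false] at this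
    have hle := Finset.single_le_sum (f := fun t => y (Sum.inl (r[k].person, t)))
      (fun t _ => hnn _) (Finset.mem_univ r[k].task)
    have := hnn (Sum.inl (r[k].person, r[k].task))
    linarith
  refine ⟨a.circuit, ⟨hcirc, 1, one_pos, ?_⟩, fun s => rfl⟩
  rw [one_smul]
  refine hy.add_mem (Augmentation.circuit_mem_ker hpath) (isCircuit_unit hcirc).1 ?_ ?_
  · rintro (e | (l | t) | (l | t)) hi
    · simp only [Augmentation.circuit, a, pathVector, Sum.elim_inl, Pi.single_apply, sub_zero]
      split_ifs <;> norm_num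
    · simp [Augmentation.circuit]
    · have : t ≠ r[k].task := by
        rintro rfl
        rw [hy.slack] at hi
        simp only [stageSlack, Sum.elim_inl, Sum.elim_inr, h2, if_false, one_ne_zero] at hi
      simp [Augmentation.circuit, a, this]
    · have : l ≠ r[k].person := by
        rintro rfl
        rw [hy.slack] at hi
        simp only [stageSlack, Sum.elim_inl, Sum.elim_inr, h1, if_false, one_ne_zero] at hi
      simp [Augmentation.circuit, a, this]
    · simp [Augmentation.circuit]
  · intro e he
    have : e ≠ (r[k].person, r[k].task) := by
      rintro rfl
      rw [hx] at he
      norm_num at he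
    simp [Augmentation.circuit, a, pathVector, this]

/-- The single-arc circuit for the next pair costs at most `-2M + 4D(k+1) + (D - 1)`, the threshold
that every circuit with other slacks exceeds by `pairSlack_or_lt`. -/
theorem IsStage.pairSlack_of_isDantzigCircuit {r : List (Augmentation L T)}
    (hr : IsCompleteOrder r) {k : ℕ} (hk : k < r.length)
    {y g : (L × T) ⊕ (L ⊕ T) ⊕ (L ⊕ T) → ℝ} (hy : IsStage r k y) {C : Matrix L T ℝ} {M : ℝ}
    (hM : 10 * costBound C * (r.length + 1) ≤ M)
    (hg : (assignmentSystem L T).IsDantzigCircuit (objective C M r) y g) :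
    ∀ s, g (Sum.inr s) = pairSlack r[k] s := by
  refine (hy.pairSlack_or_lt hr hk hg.1 hM).resolve_right fun hlt => ?_
  obtain ⟨h, hh, hs⟩ := hy.exists_feasible hr hk
  have h1 := hg.2 h hh
  have hx := abs_le.mp (abs_sum_cost_le C (fun a => (isCircuit_unit hh.1).1 (Sum.inl a)))
  rw [objective_dotProduct_of_pairSlack hr hk hs] at h1
  linarith

/-- Walks with Dantzig's rule match the pairs in the given order. -/
theorem isStage_of_isDantzigWalk {r : List (Augmentation L T)} (hr : IsCompleteOrder r)
    {C : Matrix L T ℝ} {M : ℝ} (hM : 10 * costBound C * (r.length + 1) ≤ M) {k : ℕ}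
    {y g : ℕ → (L × T) ⊕ (L ⊕ T) ⊕ (L ⊕ T) → ℝ}
    (hw : (assignmentSystem L T).IsDantzigWalk (objective C M r) k y g) (h0 : IsStage r 0 (y 0))
    {i : ℕ} (hik : i ≤ k) (hir : i ≤ r.length) : IsStage r i (y i) := by
  induction i with
  | zero => exact h0
  | succ i ih =>
    have hst := ih (by omega) (by omega)
    obtain ⟨hdan, -⟩ := hw.2 i hik
    have hs := hst.pairSlack_of_isDantzigCircuit hr hir hM hdan
    rw [hst.eq_add_of_isMaximalStep hr hir hdan.1 hs (hw.1.2.2 i hik).2]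
    exact (hst.add hr hir hdan.1 hs).1

end Stage

/-! ### Invariants of the Hungarian Method -/

section HungarianInvariants

variable {L T : Type*} [Fintype L] [Fintype T] [DecidableEq L] [DecidableEq T]

/-- `(u, v)` is a dual solution that is tight on `S`. -/
structure IsPotential (C : Matrix L T ℝ) (u : L → ℝ) (v : T → ℝ) (S : Finset (L × T)) : Prop where
  le : ∀ l t, u l + v t ≤ C l t
  tight : ∀ a ∈ S, u a.1 + v a.2 = C a.1 a.2

/-- The augmentation `a` is along a simple augmenting path for `S` of tight arcs. -/
structure IsTightAugmentation (C : Matrix L T ℝ) (S : Finset (L × T)) (a : Augmentation L T) :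
    Prop where
  path : AugPath S a.person a.task a.path
  unmatched : ∀ t, (a.person, t) ∉ S
  potential : ∃ u v, IsPotential C u v S ∧ ∀ e ∈ a.path, u e.1 + v e.2 = C e.1 e.2

/-- The matching that results from a list of augmentations. -/
def currentMatching (r : List (Augmentation L T)) : Finset (L × T) :=
  r.foldl (fun S a => flipAlong S a.path) ∅

/-- Each augmentation in the list is a tight augmentation of the current matching. -/
inductive TightRun (C : Matrix L T ℝ) : List (Augmentation L T) → Prop
  | nil : TightRun C []
  | snoc (r : List (Augmentation L T)) (a : Augmentation L T) :
      TightRun C r → IsTightAugmentation C (currentMatching r) a → TightRun C (r ++ [a])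

omit [Fintype L] [Fintype T] in
theorem currentMatching_snoc (r : List (Augmentation L T)) (a : Augmentation L T) :
    currentMatching (r ++ [a]) = flipAlong (currentMatching r) a.path := by
  simp [currentMatching, List.foldl_append]

omit [Fintype L] [Fintype T] in
theorem mem_flipAlong {S : Finset (L × T)} {p : List (L × T)} {e : L × T} :
    e ∈ flipAlong S p ↔ (e ∈ S ∧ e ∉ p) ∨ (e ∈ p ∧ e ∉ S) := by
  simp [flipAlong]

omit [Fintype L] [Fintype T] in
theorem AugPath.indicator_flipAlong {S : Finset (L × T)} {l : L} {t : T} {p : List (L × T)}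
    (h : AugPath S l t p) (e : L × T) :
    (if e ∈ flipAlong S p then (1 : ℝ) else 0) = (if e ∈ S then 1 else 0) + pathVector p e := by
  rw [h.pathVector_apply]
  by_cases h1 : e ∈ S <;> by_cases h2 : e ∈ p <;> simp [mem_flipAlong, h1, h2]

omit [Fintype L] [Fintype T] [DecidableEq L] [DecidableEq T] in
theorem AugPath.task_unmatched {S : Finset (L × T)} {l : L} {t : T} {p : List (L × T)}
    (h : AugPath S l t p) : ∀ l', (l', t) ∉ S := by
  induction h with
  | last l t hS => exact hS
  | cons l t' l' t p h1 h2 hp hl ht ih => exact ih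

/-- Flipping along a path adds its path vector to the incidence vector of the matching, which raises
only the row sum of the new person and the column sum of the new task. Both were unmatched, so
neither occurs earlier in the list. -/
theorem TightRun.matched {C : Matrix L T ℝ} {r : List (Augmentation L T)} (hr : TightRun C r) :
    (r.map Augmentation.person).Nodup ∧ (r.map Augmentation.task).Nodup ∧
    (∀ l, ∑ t, (if (l, t) ∈ currentMatching r then (1 : ℝ) else 0) =
      if l ∈ r.map Augmentation.person then 1 else 0) ∧
    (∀ t, ∑ l, (if (l, t) ∈ currentMatching r then (1 : ℝ) else 0) =
      if t ∈ r.map Augmentation.task then 1 else 0) := by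
  induction hr with
  | nil => simp [currentMatching]
  | snoc r a hr ha ih =>
    obtain ⟨hp, ht, hrow, hcol⟩ := ih
    have hpn : a.person ∉ r.map Augmentation.person := by
      intro hmem
      have := hrow a.person
      rw [if_pos hmem, Finset.sum_eq_zero (fun t _ => if_neg (ha.unmatched t))] at this
      norm_num at this
    have htn : a.task ∉ r.map Augmentation.task := by
      intro hmem
      have := hcol a.task
      rw [if_pos hmem, Finset.sum_eq_zero (fun l _ => if_neg (ha.path.task_unmatched l))] at this
      norm_num at this
    refine ⟨?_, ?_, fun l => ?_, fun t => ?_⟩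
    · rw [List.map_append, List.nodup_append_comm]
      exact List.nodup_cons.mpr ⟨hpn, hp⟩
    · rw [List.map_append, List.nodup_append_comm]
      exact List.nodup_cons.mpr ⟨htn, ht⟩
    · simp only [currentMatching_snoc, ha.path.indicator_flipAlong, Finset.sum_add_distrib, hrow,
        ha.path.sum_row_pathVector, List.map_append, List.map_cons, List.map_nil, List.mem_append,
        List.mem_singleton]
      by_cases h : l = a.person
      · rw [h, if_neg hpn]; simp
      · simp [h]
    · simp only [currentMatching_snoc, ha.path.indicator_flipAlong, Finset.sum_add_distrib, hcol,
        ha.path.sum_col_pathVector, List.map_append, List.map_cons, List.map_nil, List.mem_append,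
        List.mem_singleton]
      by_cases h : t = a.task
      · rw [h, if_neg htn]; simp
      · simp [h]

theorem eq_of_sum_indicator_le_one {ι : Type*} [Fintype ι] [DecidableEq ι] {P : ι → Prop}
    [DecidablePred P] (h : ∑ i, (if P i then (1 : ℝ) else 0) ≤ 1) {i j : ι} (hi : P i)
    (hj : P j) : i = j := by
  by_contra hne
  have h1 := Finset.sum_le_sum_of_subset_of_nonneg (Finset.subset_univ {i, j})
    (f := fun i => if P i then (1 : ℝ) else 0) (fun i _ _ => by split_ifs <;> norm_num)
  rw [Finset.sum_pair hne, if_pos hi, if_pos hj] at h1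
  linarith

theorem TightRun.row_unique {C : Matrix L T ℝ} {r : List (Augmentation L T)} (hr : TightRun C r)
    {l : L} {t t' : T} (h : (l, t) ∈ currentMatching r) (h' : (l, t') ∈ currentMatching r) :
    t = t' := by
  refine eq_of_sum_indicator_le_one (P := fun t => (l, t) ∈ currentMatching r) ?_ h h'
  rw [hr.matched.2.2.1 l]
  split_ifs <;> norm_num

theorem TightRun.col_unique {C : Matrix L T ℝ} {r : List (Augmentation L T)} (hr : TightRun C r)
    {l l' : L} {t : T} (h : (l, t) ∈ currentMatching r) (h' : (l', t) ∈ currentMatching r) :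
    l = l' := by
  refine eq_of_sum_indicator_le_one (P := fun l => (l, t) ∈ currentMatching r) ?_ h h'
  rw [hr.matched.2.2.2 t]
  split_ifs <;> norm_num

theorem TightRun.exists_mem_row_iff {C : Matrix L T ℝ} {r : List (Augmentation L T)}
    (hr : TightRun C r) (l : L) :
    (∃ t, (l, t) ∈ currentMatching r) ↔ l ∈ r.map Augmentation.person := by
  have h := hr.matched.2.2.1 l
  constructor
  · rintro ⟨t, ht⟩
    by_contra hn
    rw [if_neg hn, Finset.sum_eq_zero_iff_of_nonneg fun t _ => by split_ifs <;> norm_num] at h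
    simpa [ht] using h t (Finset.mem_univ t)
  · intro hm
    by_contra! hn
    rw [if_pos hm, Finset.sum_eq_zero fun t _ => if_neg (hn t)] at h
    norm_num at h

theorem TightRun.exists_mem_col_iff {C : Matrix L T ℝ} {r : List (Augmentation L T)}
    (hr : TightRun C r) (t : T) :
    (∃ l, (l, t) ∈ currentMatching r) ↔ t ∈ r.map Augmentation.task := by
  have h := hr.matched.2.2.2 t
  constructor
  · rintro ⟨l, hl⟩
    by_contra hn
    rw [if_neg hn, Finset.sum_eq_zero_iff_of_nonneg fun t _ => by split_ifs <;> norm_num] at h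
    simpa [hl] using h l (Finset.mem_univ l)
  · intro hm
    by_contra! hn
    rw [if_pos hm, Finset.sum_eq_zero fun l _ => if_neg (hn l)] at h
    norm_num at h

/-! ### Alternating sequences of zeros as simple augmenting paths -/

namespace AlternatingPath

variable {S P : Finset (L × T)} {l : L} {t : T} {p : List (L × T)}

omit [Fintype L] [Fintype T] [DecidableEq L] [DecidableEq T] in
theorem mem_or_mem (h : AlternatingPath S P l t p) : ∀ a ∈ p, a ∈ P ∨ a ∈ S := by
  induction h with
  | last l t hP hS => simp [hP]
  | cons l t' l' t p hP hS hp ih =>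
    intro a ha
    rcases List.mem_cons.mp ha with rfl | ha
    · exact Or.inl hP
    · rcases List.mem_cons.mp ha with rfl | ha
      · exact Or.inr hS
      · exact ih a ha

omit [Fintype L] [Fintype T] [DecidableEq L] [DecidableEq T] in
theorem head_mem (h : AlternatingPath S P l t p) : ∃ t', (l, t') ∈ p ∧ (l, t') ∈ P := by
  cases h with
  | last l t hP hS => exact ⟨t, by simp, hP⟩
  | cons l t' l' t p hP hS hp => exact ⟨t', by simp, hP⟩

omit [Fintype L] [Fintype T] [DecidableEq L] [DecidableEq T] in
theorem exists_primed_in_row (h : AlternatingPath S P l t p) :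
    ∀ a ∈ p, ∃ t', (a.1, t') ∈ p ∧ (a.1, t') ∈ P := by
  induction h with
  | last l t hP hS => simp [hP]
  | cons l t' l' t p hP hS hp ih =>
    intro a ha
    rcases List.mem_cons.mp ha with rfl | ha
    · exact ⟨t', by simp, hP⟩
    · rcases List.mem_cons.mp ha with rfl | ha
      · obtain ⟨t'', h1, h2⟩ := hp.head_mem
        exact ⟨t'', by simp [h1], h2⟩
      · obtain ⟨t'', h1, h2⟩ := ih a ha
        exact ⟨t'', by simp [h1], h2⟩

omit [Fintype L] [Fintype T] [DecidableEq L] [DecidableEq T] in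
theorem exists_starred_in_col (h : AlternatingPath S P l t p) :
    ∀ a ∈ p, (∃ l', (l', a.2) ∈ p ∧ (l', a.2) ∈ S) ∨ ∀ l', (l', a.2) ∉ S := by
  induction h with
  | last l t hP hS =>
    intro a ha
    rw [List.mem_singleton.mp ha]
    exact Or.inr hS
  | cons l t' l' t p hP hS hp ih =>
    intro a ha
    rcases List.mem_cons.mp ha with rfl | ha
    · exact Or.inl ⟨l', by simp, hS⟩
    · rcases List.mem_cons.mp ha with rfl | ha
      · exact Or.inl ⟨l', by simp, hS⟩
      · rcases ih a ha with ⟨l'', h1, h2⟩ | h1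
        · exact Or.inl ⟨l'', by simp [h1], h2⟩
        · exact Or.inr h1

omit [Fintype L] [Fintype T] [DecidableEq L] [DecidableEq T] in
-- Rows contain at most one prime and columns at most one star, so revisiting a row or a column
-- would repeat an arc; thus `Nodup` on arcs makes the path simple. The condition `hl` keeps the
-- first arc out of `S` and is passed on by uniqueness of stars in a row.
theorem augPath (hrow : ∀ l t t', (l, t) ∈ S → (l, t') ∈ S → t = t')
    (hcol : ∀ l l' t, (l, t) ∈ S → (l', t) ∈ S → l = l')
    (hP : ∀ l t t', (l, t) ∈ P → (l, t') ∈ P → t = t')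
    (h : AlternatingPath S P l t p) (hnd : p.Nodup) (hl : ∀ t', (l, t') ∈ S → (l, t') ∉ p) :
    AugPath S l t p := by
  induction h with
  | last l t hP hS => exact AugPath.last l t hS
  | cons l t' l' t p hPm hSm hp ih =>
    obtain ⟨h1, h2⟩ := List.nodup_cons.mp hnd
    obtain ⟨h3, h4⟩ := List.nodup_cons.mp h2
    refine AugPath.cons l t' l' t p (fun hm => hl t' hm (by simp)) hSm (ih h4 ?_) ?_ ?_
    · intro t'' hm
      rw [hrow l' t'' t' hm hSm]
      exact h3
    · rintro a ha rfl
      obtain ⟨t'', h5, h6⟩ := hp.exists_primed_in_row a ha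
      rw [hP _ _ _ h6 hPm] at h5
      exact h1 (List.mem_cons_of_mem _ h5)
    · rintro a ha rfl
      rcases hp.exists_starred_in_col a ha with ⟨l'', h5, h6⟩ | h5
      · rw [hcol _ _ _ h6 hSm] at h5
        exact h3 h5
      · exact h5 l' hSm

end AlternatingPath

/-! ### Reduced costs and the loop invariants -/

/-- `C'` is a nonnegative matrix of reduced costs for `C`. -/
def IsReduced (C C' : Matrix L T ℝ) : Prop :=
  (∀ l t, 0 ≤ C' l t) ∧ ∃ (u : L → ℝ) (v : T → ℝ), ∀ l t, C' l t = C l t - (u l + v t)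

omit [Fintype L] [Fintype T] [DecidableEq L] [DecidableEq T] in
theorem IsReduced.exists_potential {C C' : Matrix L T ℝ} (h : IsReduced C C')
    {S : Finset (L × T)} (hS : ∀ a ∈ S, C' a.1 a.2 = 0) :
    ∃ u v, IsPotential C u v S ∧ ∀ a : L × T, C' a.1 a.2 = 0 → u a.1 + v a.2 = C a.1 a.2 := by
  obtain ⟨hnn, u, v, huv⟩ := h
  have ht : ∀ a : L × T, C' a.1 a.2 = 0 → u a.1 + v a.2 = C a.1 a.2 := fun a ha => by
    have := huv a.1 a.2
    linarith
  refine ⟨u, v, ⟨fun l t => ?_, fun a ha => ht a (hS a ha)⟩, ht⟩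
  have h1 := hnn l t
  have h2 := huv l t
  linarith

/-- The invariants of the main loop. -/
structure TableauInv (C : Matrix L T ℝ) (τ : Tableau L T) (r : List (Augmentation L T)) :
    Prop where
  run : TightRun C r
  starred_eq : τ.starred = currentMatching r
  reduced : IsReduced C τ.cost
  starred_zero : ∀ a ∈ τ.starred, τ.cost a.1 a.2 = 0
  primed_zero : ∀ a ∈ τ.primed, τ.cost a.1 a.2 = 0
  primed_rows : ∀ a ∈ τ.primed, a.1 ∈ τ.rows
  primed_cols : ∀ a ∈ τ.primed, a.2 ∉ τ.cols
  primed_unique : ∀ l t t', (l, t) ∈ τ.primed → (l, t') ∈ τ.primed → t = t'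
  starred_cover : ∀ a ∈ τ.starred, a.1 ∈ τ.rows ↔ a.2 ∉ τ.cols

omit [Fintype L] [Fintype T] in
theorem TableauInv.reset {C C' : Matrix L T ℝ} {r : List (Augmentation L T)} {S : Finset (L × T)}
    (hr : TightRun C r) (hS : S = currentMatching r) (hC : IsReduced C C')
    (h0 : ∀ a ∈ S, C' a.1 a.2 = 0) : TableauInv C ⟨C', S, ∅, ∅, starredCols S⟩ r where
  run := hr
  starred_eq := hS
  reduced := hC
  starred_zero := h0
  primed_zero := by simp
  primed_rows := by simp
  primed_cols := by simp
  primed_unique := by simp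
  starred_cover a ha := by
    have : a.2 ∈ starredCols S := Finset.mem_image_of_mem _ ha
    simp [this]

/-- The invariants of the Hungarian Method. -/
def StateInv (C : Matrix L T ℝ) : HungarianState L T → List (Augmentation L T) → Prop
  | .greedy C' todo S, r => TightRun C r ∧ S = currentMatching r ∧ IsReduced C C' ∧
      (∀ a ∈ S, C' a.1 a.2 = 0) ∧ (∀ a ∈ todo, C' a.1 a.2 = 0) ∧ ∀ t, ∃ l, C' l t = 0
  | .outer τ, r => TableauInv C τ r ∧
      (starredCols τ.starred = Finset.univ ∨ ∃ z, τ.UncoveredZero z)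
  | .inner τ, r => TableauInv C τ r
  | .done _, r => TightRun C r ∧ (∃ u v, IsPotential C u v (currentMatching r)) ∧
      starredCols (currentMatching r) = Finset.univ

theorem StateInv.init (hLT : Fintype.card L = Fintype.card T) (C : Matrix L T ℝ) :
    StateInv C (.greedy (subtractColMin (subtractRowMin C))
        (zeros (subtractColMin (subtractRowMin C))) ∅) [] := by
  refine ⟨TightRun.nil, rfl, ⟨fun l t => ?_, fun l => ⨅ t', C l t',
    fun t => ⨅ l', subtractRowMin C l' t, fun l t => ?_⟩, by simp, ?_, fun t => ?_⟩
  · rw [subtractColMin, Matrix.of_apply, sub_nonneg]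
    exact ciInf_le (Set.finite_range _).bddBelow l
  · rw [subtractColMin, Matrix.of_apply]
    simp only [subtractRowMin, Matrix.of_apply]
    ring
  · intro a ha
    simpa [zeros] using ha
  -- A column minimum is attained only if there are rows; equal cardinalities provide one as soon as
  -- there is a column.
  · have hL : Nonempty L := by
      rw [← Fintype.card_pos_iff, hLT]
      exact Fintype.card_pos_iff.mpr ⟨t⟩
    obtain ⟨l, hl⟩ := exists_eq_ciInf_of_finite (f := fun l' => subtractRowMin C l' t)
    exact ⟨l, by rw [subtractColMin, Matrix.of_apply, ← hl, sub_self]⟩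

theorem TableauInv.isTightAugmentation {C : Matrix L T ℝ} {τ : Tableau L T}
    {r : List (Augmentation L T)} (h : TableauInv C τ r) {l : L} {t₀ t : T} {p : List (L × T)}
    (hz : τ.UncoveredZero (l, t₀)) (hl : ∀ t', (l, t') ∉ τ.starred)
    (hp : AlternatingPath τ.starred (insert (l, t₀) τ.primed) l t ((l, t₀) :: p))
    (hnd : ((l, t₀) :: p).Nodup) :
    (∀ a ∈ (l, t₀) :: p, τ.cost a.1 a.2 = 0) ∧
      IsTightAugmentation C (currentMatching r) ⟨l, t, (l, t₀) :: p⟩ := by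
  have hzero : ∀ a ∈ (l, t₀) :: p, τ.cost a.1 a.2 = 0 := by
    intro a ha
    rcases hp.mem_or_mem a ha with ha | ha
    · rcases Finset.mem_insert.mp ha with rfl | ha
      · exact hz.1
      · exact h.primed_zero a ha
    · exact h.starred_zero a ha
  refine ⟨hzero, ?_, ?_, ?_⟩
  · rw [← h.starred_eq]
    refine hp.augPath ?_ ?_ ?_ hnd fun t' ht' => absurd ht' (hl t')
    · rw [h.starred_eq]
      exact fun _ _ _ h1 h2 => h.run.row_unique h1 h2
    · rw [h.starred_eq]
      exact fun _ _ _ h1 h2 => h.run.col_unique h1 h2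
    -- Earlier primes lie in covered rows, while the new prime is in an uncovered one.
    · intro l' t₁ t₂ h1 h2
      rcases Finset.mem_insert.mp h1 with e1 | h1 <;> rcases Finset.mem_insert.mp h2 with e2 | h2
      · rw [(Prod.mk.inj e1).2, (Prod.mk.inj e2).2]
      · rw [(Prod.mk.inj e1).1] at h2
        exact absurd (h.primed_rows _ h2) hz.2.1
      · rw [(Prod.mk.inj e2).1] at h1
        exact absurd (h.primed_rows _ h1) hz.2.1
      · exact h.primed_unique _ _ _ h1 h2
  · rw [← h.starred_eq]
    exact hl
  · rw [← h.starred_eq]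
    obtain ⟨u, v, hpot, ht⟩ := h.reduced.exists_potential h.starred_zero
    exact ⟨u, v, hpot, fun e he => ht e (hzero e he)⟩

theorem TableauInv.flip {C : Matrix L T ℝ} {τ : Tableau L T}
    {r : List (Augmentation L T)} (h : TableauInv C τ r) {l : L} {t₀ t : T} {p : List (L × T)}
    (hz : τ.UncoveredZero (l, t₀)) (hl : ∀ t', (l, t') ∉ τ.starred)
    (hp : AlternatingPath τ.starred (insert (l, t₀) τ.primed) l t ((l, t₀) :: p))
    (hnd : ((l, t₀) :: p).Nodup) :
    TableauInv C ⟨τ.cost, flipAlong τ.starred ((l, t₀) :: p), ∅, ∅,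
      starredCols (flipAlong τ.starred ((l, t₀) :: p))⟩ (r ++ [⟨l, t, (l, t₀) :: p⟩]) := by
  obtain ⟨hzero, haug⟩ := h.isTightAugmentation hz hl hp hnd
  refine TableauInv.reset (h.run.snoc _ _ haug) ?_ h.reduced fun a ha => ?_
  · rw [currentMatching_snoc, h.starred_eq]
  · rcases mem_flipAlong.mp ha with ha | ha
    · exact h.starred_zero a ha.1
    · exact hzero a ha.1

theorem TableauInv.prime {C : Matrix L T ℝ} {τ : Tableau L T} {r : List (Augmentation L T)}
    (h : TableauInv C τ r) {z s : L × T} (hz : τ.UncoveredZero z) (hs : s ∈ τ.starred)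
    (hsz : s.1 = z.1) :
    TableauInv C ⟨τ.cost, τ.starred, insert z τ.primed, insert z.1 τ.rows, τ.cols.erase s.2⟩ r where
  run := h.run
  starred_eq := h.starred_eq
  reduced := h.reduced
  starred_zero := h.starred_zero
  primed_zero a ha := by
    rcases Finset.mem_insert.mp ha with rfl | ha
    · exact hz.1
    · exact h.primed_zero a ha
  primed_rows a ha := by
    rcases Finset.mem_insert.mp ha with rfl | ha
    · exact Finset.mem_insert_self _ _
    · exact Finset.mem_insert_of_mem (h.primed_rows a ha)
  primed_cols a ha hc := by
    have hc' := Finset.mem_of_mem_erase hc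
    rcases Finset.mem_insert.mp ha with rfl | ha
    · exact hz.2.2 hc'
    · exact h.primed_cols a ha hc'
  primed_unique l t t' h1 h2 := by
    rcases Finset.mem_insert.mp h1 with rfl | h3 <;> rcases Finset.mem_insert.mp h2 with e4 | h4
    · exact (Prod.mk.inj e4).2.symm
    · exact absurd (h.primed_rows _ h4) hz.2.1
    · subst e4
      exact absurd (h.primed_rows _ h3) hz.2.1
    · exact h.primed_unique _ _ _ h3 h4
  -- For `s` the cover moves from its column to its row; every other star lies in a different row
  -- and column, so its cover is unaffected.
  starred_cover a ha := by
    have hcov := h.starred_cover a ha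
    simp only [Finset.mem_insert, Finset.mem_erase, not_and]
    by_cases has : a = s
    · subst has
      simp [hsz]
    · have hS := h.starred_eq
      have h1 : a.1 ≠ z.1 := by
        intro heq
        refine has (Prod.ext (heq.trans hsz.symm) (h.run.row_unique (l := a.1) ?_ ?_))
        · rw [← hS]; exact ha
        · rw [← hS, heq, ← hsz]; exact hs
      have h2 : a.2 ≠ s.2 := by
        intro heq
        refine has (Prod.ext (h.run.col_unique (t := a.2) ?_ ?_) heq)
        · rw [← hS]; exact ha
        · rw [← hS, heq]; exact hs
      simp [h1, h2, hcov]

omit [Fintype L] in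
-- The update is a shift of the potential. A starred zero is covered by exactly one line and a
-- primed zero by its row only, so neither changes. Minimality of `d` keeps the matrix nonnegative,
-- and the entry attaining it becomes an uncovered zero, so the outer loop cannot stop here.
theorem TableauInv.update {C : Matrix L T ℝ} {τ : Tableau L T} {r : List (Augmentation L T)}
    (h : TableauInv C τ r) {d : ℝ}
    (hd : IsLeast {x | ∃ l t, l ∉ τ.rows ∧ t ∉ τ.cols ∧ x = τ.cost l t} d) :
    StateInv C (.outer ⟨Matrix.of fun l t =>
            τ.cost l t + (if l ∈ τ.rows then d else 0) - (if t ∈ τ.cols then 0 else d),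
          τ.starred, τ.primed, τ.rows, τ.cols⟩) r := by
  obtain ⟨⟨l₀, t₀, hl₀, ht₀, rfl⟩, hmin⟩ := hd
  obtain ⟨hnn, u, v, huv⟩ := h.reduced
  have hd0 := hnn l₀ t₀
  refine ⟨⟨h.run, h.starred_eq, ⟨fun l t => ?_, fun l => u l - if l ∈ τ.rows then τ.cost l₀ t₀ else 0,
    fun t => v t + if t ∈ τ.cols then 0 else τ.cost l₀ t₀, fun l t => ?_⟩, fun a ha => ?_,
    fun a ha => ?_, h.primed_rows, h.primed_cols, h.primed_unique, h.starred_cover⟩,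
    Or.inr ⟨(l₀, t₀), ?_, hl₀, ht₀⟩⟩
  · have := hnn l t
    by_cases h1 : l ∈ τ.rows <;> by_cases h2 : t ∈ τ.cols <;> simp [h1, h2]
    · linarith
    · linarith
    · linarith
    · exact hmin ⟨l, t, h1, h2, rfl⟩
  · simp only [Matrix.of_apply, huv l t]
    split_ifs <;> ring
  · have h1 := h.starred_zero a ha
    have h2 := h.starred_cover a ha
    by_cases h3 : a.2 ∈ τ.cols <;> simp [h1, h2, h3]
  · simp [h.primed_zero a ha, h.primed_rows a ha, h.primed_cols a ha]
  · simp [hl₀, ht₀]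

theorem HungarianReaches.stateInv (hLT : Fintype.card L = Fintype.card T) {C : Matrix L T ℝ}
    {σ : HungarianState L T} {r : List (Augmentation L T)} (h : HungarianReaches C σ r) :
    StateInv C σ r := by
  induction h with
  | init => exact StateInv.init hLT C
  | greedyStar C' todo S r z hreach hz hS ih =>
    obtain ⟨hrun, rfl, hred, hzero, htodo, hcol⟩ := ih
    have hzS : z ∉ currentMatching r := fun hm => (hS z hm).1 rfl
    have haug : IsTightAugmentation C (currentMatching r) ⟨z.1, z.2, [z]⟩ := by
      refine ⟨AugPath.last z.1 z.2 fun l' hm => (hS _ hm).2 rfl, fun t hm => (hS _ hm).1 rfl, ?_⟩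
      obtain ⟨u, v, hpot, ht⟩ := hred.exists_potential hzero
      refine ⟨u, v, hpot, fun e he => ht e ?_⟩
      rw [List.mem_singleton.mp he]
      exact htodo z hz
    refine ⟨hrun.snoc _ _ haug, ?_, hred, fun a ha => ?_,
      fun a ha => htodo a (Finset.mem_of_mem_erase ha), hcol⟩
    · rw [currentMatching_snoc]
      ext e
      rw [mem_flipAlong, Finset.mem_insert, List.mem_singleton]
      by_cases he : e = z
      · subst he; simp [hzS]
      · simp [he]
    · rcases Finset.mem_insert.mp ha with rfl | ha
      · exact htodo a hz
      · exact hzero a ha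
  | greedySkip C' todo S r z hreach hz hS ih =>
    obtain ⟨hrun, hSr, hred, hzero, htodo, hcol⟩ := ih
    exact ⟨hrun, hSr, hred, hzero, fun a ha => htodo a (Finset.mem_of_mem_erase ha), hcol⟩
  | greedyEnd C' S r hreach ih =>
    obtain ⟨hrun, hSr, hred, hzero, htodo, hcol⟩ := ih
    refine ⟨TableauInv.reset hrun hSr hred hzero, ?_⟩
    -- A column without a star still has a zero from the column subtraction, and no row is covered
    -- yet.
    by_cases huniv : starredCols S = Finset.univ
    · exact Or.inl huniv
    · right
      obtain ⟨t, ht⟩ := not_forall.mp (mt Finset.eq_univ_iff_forall.mpr huniv)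
      obtain ⟨l, hl⟩ := hcol t
      exact ⟨(l, t), hl, Finset.notMem_empty _, ht⟩
  | outerEnter τ r hreach hex ih => exact ih.1
  | outerExit τ r hreach hno ih =>
    obtain ⟨hinv, hcol⟩ := ih
    obtain ⟨u, v, hpot, -⟩ := hinv.reduced.exists_potential hinv.starred_zero
    rw [hinv.starred_eq] at hpot hcol
    -- Without an uncovered zero, the invariant at the loop head leaves only the case that all
    -- columns are starred.
    exact ⟨hinv.run, ⟨u, v, hpot⟩, hcol.resolve_right fun ⟨z, hz⟩ => hno z hz⟩
  | innerPrime τ r z s hreach hz hs hsz ih => exact TableauInv.prime ih hz hs hsz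
  | innerAugment τ r l t₀ t p hreach hz hl hp hnd hcols ih =>
    exact TableauInv.flip ih hz hl hp hnd
  | innerFinish τ r l t₀ t p hreach hz hl hp hnd hcols ih =>
    have hinv := TableauInv.flip ih hz hl hp hnd
    obtain ⟨u, v, hpot, -⟩ := hinv.reduced.exists_potential hinv.starred_zero
    have hS := hinv.starred_eq
    simp only at hS hpot
    rw [hS] at hpot hcols
    exact ⟨hinv.run, ⟨u, v, hpot⟩, hcols⟩
  | innerUpdate τ r d hreach hno hd ih => exact TableauInv.update ih hd

/-- A complete run consists of tight augmentations, matches everybody, and ends with an optimal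
matching. -/
theorem IsHungarianRun.spec (hLT : Fintype.card L = Fintype.card T) {C : Matrix L T ℝ}
    {r : List (Augmentation L T)} (hr : IsHungarianRun C r) :
    TightRun C r ∧ IsCompleteOrder r ∧ r.length = Fintype.card L ∧
      ∃ u v, IsPotential C u v (currentMatching r) := by
  obtain ⟨τ, hτ⟩ := hr
  obtain ⟨hrun, hpot, hcols⟩ := hτ.stateInv hLT
  obtain ⟨hp, ht, -, -⟩ := hrun.matched
  have htask : ∀ t, t ∈ r.map Augmentation.task := by
    intro t
    rw [← hrun.exists_mem_col_iff]
    obtain ⟨a, ha, rfl⟩ := Finset.mem_image.mp (Finset.eq_univ_iff_forall.mp hcols t)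
    exact ⟨a.1, ha⟩
  -- The tasks of the run are distinct and exhaust `T`; as `|L| = |T|`, the equally many distinct
  -- persons exhaust `L`.
  have hlen : r.length = Fintype.card L := by
    rw [hLT, ← Finset.card_univ,
      ← Finset.eq_univ_of_forall (s := (r.map Augmentation.task).toFinset) (by simpa using htask),
      List.toFinset_card_of_nodup ht, List.length_map]
  have hperson : (r.map Augmentation.person).toFinset = Finset.univ := by
    rw [← Finset.card_eq_iff_eq_univ, List.toFinset_card_of_nodup hp, List.length_map, hlen]
  refine ⟨hrun, ⟨hp, ht, fun l => ?_, htask⟩, hlen, hpot⟩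
  rw [← List.mem_toFinset, hperson]
  exact Finset.mem_univ l

end HungarianInvariants

/-! ### The walk of the Hungarian Method -/

section Walk

variable {L T : Type*} [Fintype L] [Fintype T] [DecidableEq L] [DecidableEq T]

omit [Fintype L] [Fintype T] in
theorem TightRun.take {C : Matrix L T ℝ} {r : List (Augmentation L T)} (hr : TightRun C r)
    (k : ℕ) : TightRun C (r.take k) ∧
      ∀ hk : k < r.length, IsTightAugmentation C (currentMatching (r.take k)) r[k] := by
  induction hr with
  | nil => exact ⟨by simpa using TightRun.nil, fun hk => absurd hk (Nat.not_lt_zero _)⟩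
  | snoc r a hr ha ih =>
    rcases lt_or_ge r.length k with hk | hk
    · rw [List.take_of_length_le (by simpa using hk)]
      refine ⟨hr.snoc _ _ ha, fun hk' => ?_⟩
      simp only [List.length_append, List.length_singleton] at hk'
      omega
    · rw [List.take_append_of_le_length hk]
      refine ⟨ih.1, fun hk' => ?_⟩
      rcases hk.lt_or_eq with hlt | rfl
      · rw [List.getElem_append_left hlt]
        exact ih.2 hlt
      · rw [List.take_length, List.getElem_concat_length rfl]
        exact ha

theorem TightRun.isStage {C : Matrix L T ℝ} {r : List (Augmentation L T)} (hr : TightRun C r)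
    (k : ℕ) : IsStage r k (hungarianPoint r k) := by
  have hk := (hr.take k).1
  obtain ⟨-, -, hrow, hcol⟩ := hk.matched
  have hslack : ∀ s, hungarianPoint r k (Sum.inr s) = stageSlack r k s := by
    rintro ((l | t) | (l | t))
    · rfl
    · exact if_congr (hk.exists_mem_col_iff t) rfl rfl
    · exact if_congr (hk.exists_mem_row_iff l) rfl rfl
    · rfl
  have hbin : ∀ i, hungarianPoint r k i = 0 ∨ hungarianPoint r k i = 1 := by
    rintro (e | (l | t) | (l | t))
    · exact (ite_eq_or_eq _ _ _).symm
    · exact Or.inl rfl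
    · exact ite_eq_or_eq _ _ _
    · exact ite_eq_or_eq _ _ _
    · exact Or.inl rfl
  refine ⟨(mem_polyhedron_iff _).mpr ⟨⟨fun l => ?_, fun t => ?_⟩, fun a => ?_, fun i => ?_⟩,
    hbin, hslack⟩
  · rw [hslack, hslack]
    have := hrow l
    change ∑ t, hungarianPoint r k (Sum.inl (l, t)) = _ at this
    rw [this]
    simp only [stageSlack, Sum.elim_inl, Sum.elim_inr]
    split_ifs <;> norm_num
  · rw [hslack, hslack]
    have := hcol t
    change ∑ l, hungarianPoint r k (Sum.inl (l, t)) = _ at this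
    rw [this]
    simp only [stageSlack, Sum.elim_inl, Sum.elim_inr]
    split_ifs <;> norm_num
  · rcases hbin (Sum.inl a) with h | h <;> rw [h]
    exact zero_le_one
  · rcases hbin i with h | h <;> rw [h]
    exact zero_le_one

omit [Fintype L] [Fintype T] in
theorem hungarianCircuit_of_lt {r : List (Augmentation L T)} {k : ℕ} (hk : k < r.length) :
    hungarianCircuit r k = r[k].circuit := by
  rw [hungarianCircuit, List.getElem?_eq_getElem hk]
  rfl

omit [Fintype L] [Fintype T] in
theorem hungarianCircuit_inr {r : List (Augmentation L T)} {k : ℕ} (hk : k < r.length)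
    (s : (L ⊕ T) ⊕ (L ⊕ T)) : hungarianCircuit r k (Sum.inr s) = pairSlack r[k] s := by
  rw [hungarianCircuit_of_lt hk]
  rfl

theorem TightRun.hungarianPoint_succ {C : Matrix L T ℝ} {r : List (Augmentation L T)}
    (hr : TightRun C r) (hc : IsCompleteOrder r) {k : ℕ} (hk : k < r.length) :
    hungarianPoint r (k + 1) = hungarianPoint r k + hungarianCircuit r k := by
  funext i
  rw [Pi.add_apply]
  rcases i with e | s
  · have h := ((hr.take k).2 hk).path.indicator_flipAlong e
    rw [← currentMatching_snoc, ← List.take_succ_eq_append_getElem hk] at h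
    rw [hungarianCircuit_of_lt hk]
    exact h
  · rw [(hr.isStage (k + 1)).slack, (hr.isStage k).slack, hungarianCircuit_inr hk,
      stageSlack_succ hc hk]

theorem TightRun.isFeasibleCircuit {C : Matrix L T ℝ} {r : List (Augmentation L T)}
    (hr : TightRun C r) (hc : IsCompleteOrder r) {k : ℕ} (hk : k < r.length) :
    (assignmentSystem L T).IsFeasibleCircuit (hungarianPoint r k) (hungarianCircuit r k) := by
  refine ⟨?_, 1, one_pos, ?_⟩
  · rw [hungarianCircuit_of_lt hk]
    exact Augmentation.circuit_isCircuit ((hr.take k).2 hk).path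
  · rw [one_smul, ← hr.hungarianPoint_succ hc hk]
    exact (hr.isStage (k + 1)).mem

/-- Summed node by node, a potential sees only the row and column sums, which the kernel equations
express by the slacks. -/
theorem sum_potential_eq {g h : (L × T) ⊕ (L ⊕ T) ⊕ (L ⊕ T) → ℝ}
    (hg : (assignmentSystem L T).A *ᵥ g = 0) (hh : (assignmentSystem L T).A *ᵥ h = 0)
    (hs : ∀ s, g (Sum.inr s) = h (Sum.inr s)) (u : L → ℝ) (v : T → ℝ) :
    ∑ a : L × T, (u a.1 + v a.2) * g (Sum.inl a) = ∑ a : L × T, (u a.1 + v a.2) * h (Sum.inl a) := by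
  have hsplit : ∀ x : L × T → ℝ, ∑ a : L × T, (u a.1 + v a.2) * x a =
      ∑ l, u l * ∑ t, x (l, t) + ∑ t, v t * ∑ l, x (l, t) := by
    intro x
    simp only [add_mul, Finset.sum_add_distrib, Finset.mul_sum]
    rw [Fintype.sum_prod_type, Fintype.sum_prod_type_right]
  obtain ⟨hg1, hg2⟩ := (assignmentSystem_A_mulVec_eq_zero_iff g).mp hg
  obtain ⟨hh1, hh2⟩ := (assignmentSystem_A_mulVec_eq_zero_iff h).mp hh
  rw [hsplit, hsplit]
  congr 1
  · refine Finset.sum_congr rfl fun l _ => ?_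
    have h1 := hg1 l
    have h2 := hh1 l
    rw [hs, hs] at h1
    congr 1
    linarith
  · refine Finset.sum_congr rfl fun t _ => ?_
    have h1 := hg2 t
    have h2 := hh2 t
    rw [hs, hs] at h1
    congr 1
    linarith

/-- Complementary slackness: matched arcs have reduced cost zero, and on the others both the reduced
cost and the feasible direction are nonnegative. -/
theorem IsPotential.sum_le {C : Matrix L T ℝ} {u : L → ℝ} {v : T → ℝ}
    {r : List (Augmentation L T)} {k : ℕ} (hp : IsPotential C u v (currentMatching (r.take k)))
    {h : (L × T) ⊕ (L ⊕ T) ⊕ (L ⊕ T) → ℝ}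
    (hh : (assignmentSystem L T).IsFeasibleCircuit (hungarianPoint r k) h) :
    ∑ a : L × T, (u a.1 + v a.2) * h (Sum.inl a) ≤ ∑ a : L × T, C a.1 a.2 * h (Sum.inl a) := by
  obtain ⟨h0, -⟩ := sign_of_isFeasibleCircuit hh
  refine Finset.sum_le_sum fun a _ => ?_
  by_cases ha : a ∈ currentMatching (r.take k)
  · rw [hp.tight a ha]
  · exact mul_le_mul_of_nonneg_right (hp.le a.1 a.2) (h0 _ (if_neg ha))

/-- Competitors with other slacks lose by `pairSlack_or_lt`. Those with the same slacks have the
same potential cost, which bounds their arc cost from below and equals the arc cost of the tight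
path. -/
theorem TightRun.isDantzigCircuit {C : Matrix L T ℝ} {r : List (Augmentation L T)}
    (hr : TightRun C r) (hc : IsCompleteOrder r) {k : ℕ} (hk : k < r.length) {M : ℝ}
    (hM : 10 * costBound C * (r.length + 1) ≤ M) :
    (assignmentSystem L T).IsDantzigCircuit (objective C M r) (hungarianPoint r k)
      (hungarianCircuit r k) ∧ objective C M r ⬝ᵥ hungarianCircuit r k < 0 := by
  have hfeas := hr.isFeasibleCircuit hc hk
  have hcost := objective_dotProduct_of_pairSlack (C := C) (M := M) hc hk (hungarianCircuit_inr hk)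
  have hx := abs_le.mp (abs_sum_cost_le C (fun a => (isCircuit_unit hfeas.1).1 (Sum.inl a)))
  refine ⟨⟨hfeas, fun h hh => ?_⟩, ?_⟩
  · rw [neg_le_neg_iff]
    rcases (hr.isStage k).pairSlack_or_lt hc hk hh hM with hs | hlt
    · rw [hcost, objective_dotProduct_of_pairSlack hc hk hs, add_le_add_iff_right]
      obtain ⟨u, v, hpot, htight⟩ := ((hr.take k).2 hk).potential
      refine le_trans (le_of_eq ?_) (hpot.sum_le hh)
      rw [sum_potential_eq hh.1.2.1 hfeas.1.2.1 (fun s => by rw [hs, hungarianCircuit_inr hk])]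
      refine Finset.sum_congr rfl fun a _ => ?_
      by_cases ha : a ∈ r[k].path
      · rw [htight a ha]
      · have hz : hungarianCircuit r k (Sum.inl a) = 0 := by
          rw [hungarianCircuit_of_lt hk]
          exact (((hr.take k).2 hk).path.pathVector_apply a).trans (if_neg ha)
        rw [hz, mul_zero, mul_zero]
    · linarith
  · rw [hcost]
    have hD := costBound_pos C
    have hkn : costBound C * (k + 1) ≤ costBound C * r.length :=
      mul_le_mul_of_nonneg_left (by exact_mod_cast hk) (by linarith)
    have hn : (0 : ℝ) ≤ costBound C * r.length := by positivity
    linarith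

/-- Zero coordinates stay zero at the ends of any segment through the point; each balance equation
then determines the one remaining slack of its node. -/
theorem hungarianPoint_zero_mem_extremePoints {C : Matrix L T ℝ} {r : List (Augmentation L T)}
    (hr : TightRun C r) :
    hungarianPoint r 0 ∈ (assignmentSystem L T).polyhedron.extremePoints ℝ := by
  refine ⟨(hr.isStage 0).mem, fun x hx y hy hxy => ?_⟩
  obtain ⟨a, b, ha, hb, -, heq⟩ := hxy
  obtain ⟨⟨hrow, hcol⟩, -, hx0⟩ := (mem_polyhedron_iff x).mp hx
  obtain ⟨-, -, hy0⟩ := (mem_polyhedron_iff y).mp hy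
  have hz : ∀ i, hungarianPoint r 0 i = 0 → x i = 0 := by
    intro i hi
    have h1 := congrFun heq i
    rw [hi, Pi.add_apply, Pi.smul_apply, Pi.smul_apply, smul_eq_mul, smul_eq_mul] at h1
    have h2 := mul_nonneg ha.le (hx0 i)
    have h3 := mul_nonneg hb.le (hy0 i)
    exact (mul_eq_zero.mp (by linarith : a * x i = 0)).resolve_left ha.ne'
  have hxa : ∀ e, x (Sum.inl e) = 0 := fun e => hz _ rfl
  have hpoint := (hr.isStage 0).slack
  funext i
  rcases i with e | (l | t) | (l | t)
  · exact hxa e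
  · exact hz _ rfl
  · rw [hpoint]
    have h1 := hcol t
    rw [Finset.sum_eq_zero fun l _ => hxa (l, t), hz (Sum.inr (Sum.inr (Sum.inr t))) rfl] at h1
    simp only [stageSlack, List.take_zero, List.map_nil, Sum.elim_inl, Sum.elim_inr,
      List.not_mem_nil, if_false]
    linarith
  · rw [hpoint]
    have h1 := hrow l
    rw [Finset.sum_eq_zero fun t _ => hxa (l, t), hz (Sum.inr (Sum.inl (Sum.inl l))) rfl] at h1
    simp only [stageSlack, List.take_zero, List.map_nil, Sum.elim_inl, Sum.elim_inr,
      List.not_mem_nil, if_false]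
    linarith
  · exact hz _ rfl

theorem TightRun.isMaximalStep {C : Matrix L T ℝ} {r : List (Augmentation L T)}
    (hr : TightRun C r) (hc : IsCompleteOrder r) {k : ℕ} (hk : k < r.length) :
    (assignmentSystem L T).IsMaximalStep (hungarianPoint r k) (hungarianCircuit r k)
      (hungarianPoint r (k + 1)) :=
  ⟨1, one_pos, by rw [one_smul, hr.hungarianPoint_succ hc hk], (hr.isStage (k + 1)).mem,
    ((hr.isStage k).add hc hk (hr.isFeasibleCircuit hc hk) (hungarianCircuit_inr hk)).2⟩

/-- Once everybody is matched, a circuit with slack arcs must increase two slacks, which is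
expensive. A circuit without them has potential cost zero, hence nonnegative arc cost. -/
theorem TightRun.optimal {C : Matrix L T ℝ} {r : List (Augmentation L T)}
    (hr : TightRun C r) (hc : IsCompleteOrder r) {u : L → ℝ} {v : T → ℝ}
    (hp : IsPotential C u v (currentMatching r)) {M : ℝ}
    (hM : 10 * costBound C * (r.length + 1) ≤ M) {h : (L × T) ⊕ (L ⊕ T) ⊕ (L ⊕ T) → ℝ}
    (hh : (assignmentSystem L T).IsFeasibleCircuit (hungarianPoint r r.length) h) :
    0 ≤ objective C M r ⬝ᵥ h := by
  have hD := costBound_pos C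
  have hx := abs_le.mp (abs_sum_cost_le C (fun a => (isCircuit_unit hh.1).1 (Sum.inl a)))
  have hn : (0 : ℝ) ≤ costBound C * r.length := by positivity
  rw [objective_dotProduct]
  rcases (hr.isStage r.length).slack_cases hc hh hM with h0 | ⟨-, hle⟩ |
    ⟨i, j, hi, hj, hki, -, -, -⟩
  · simp only [h0, mul_zero, Finset.sum_const_zero, add_zero]
    rw [← r.take_length] at hp
    refine le_trans (le_of_eq ?_) (hp.sum_le hh)
    rw [sum_potential_eq hh.1.2.1 (h := 0) (Matrix.mulVec_zero _) h0]
    simp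
  · have := hle rfl
    linarith
  · omega

end Walk

end PseudoflowCircuits

theorem theorem6 {L T : Type*} [Fintype L] [Fintype T] [DecidableEq L] [DecidableEq T]
    (hLT : Fintype.card L = Fintype.card T) (C : Matrix L T ℝ) :
    ∃ M₀ : ℝ, ∀ r : List (Augmentation L T), IsHungarianRun C r → ∀ M : ℝ, M₀ ≤ M →
      (assignmentSystem L T).IsDantzigAugmentation (objective C M r) r.length
        (hungarianPoint r) (hungarianCircuit r) ∧
      ∀ (k : ℕ) (y g : ℕ → (L × T) ⊕ (L ⊕ T) ⊕ (L ⊕ T) → ℝ),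
        (assignmentSystem L T).IsDantzigWalk (objective C M r) k y g →
        y 0 = hungarianPoint r 0 →
        ∀ i, i < k → i < r.length →
          ∀ v : (L ⊕ T) ⊕ (L ⊕ T), g i (Sum.inr v) = hungarianCircuit r i (Sum.inr v) := by
  -- Every complete run has length `|L|`, so this bound serves all runs at once.
  refine ⟨10 * costBound C * (Fintype.card L + 1), fun r hrun M hM => ?_⟩
  obtain ⟨hr, hc, hlen, u, v, hpot⟩ := hrun.spec hLT
  rw [← hlen] at hM
  refine ⟨⟨⟨⟨hungarianPoint_zero_mem_extremePoints hr, fun i _ => (hr.isStage i).mem,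
    fun i hi => ⟨(hr.isFeasibleCircuit hc hi).1, hr.isMaximalStep hc hi⟩⟩,
    fun i hi => hr.isDantzigCircuit hc hi hM⟩, fun h hh => hr.optimal hc hpot hM hh⟩, ?_⟩
  intro k y g hw h0 i hik hir s
  have hst := isStage_of_isDantzigWalk hc hM hw (h0 ▸ hr.isStage 0) hik.le hir.le
  rw [hungarianCircuit_inr hir]
  exact hst.pairSlack_of_isDantzigCircuit hc hir hM (hw.2 i hik).1 s
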